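/- **EntropyCQ.** Let $d\ge 1$, $k\ge 2$, $n\ge 1$ be integers, $R>0$, and let clients $i=1,\dots,n$ hold $x_i\in\mathbb{R}^d$ with $\|x_i\|_2\le R$. Put $\bar x=\frac1n\sum_i x_i$, $\sigma^d_{\mathrm{md}}=\frac1n\sum_i\|x_i-\bar x\|_2$ and $\beta=\frac{k+1}{k(k-1)}$. Independently for each coordinate $j$, let $\pi^j$ be a uniformly random permutation of $\{0,\dots,n-1\}$ and $c^j_1$ be uniform on $[-\frac1k,0)$ (both known to all clients and the server), and let each client $i$ draw privately $\gamma_{i}^j$ uniform on $[0,\frac1n)$; all these are independent. The levels of coordinate $j$ are $c^j_m=c_1^j+(m-1)\beta$, $1\le m\le k$. Client $i$ normalizes $y_{i}^j=\frac{x_i(j)+R}{2R}$, takes the largest level $c'=c'^j_i$ strictly below $y_i^j$, and picks the level $q_i^j=c'+\beta$ if $\frac{\pi^j_i}{n}+\gamma^j_i<\frac{y_i^j-c'}{\beta}$ and $q_i^j=c'$ otherwise. It sends the vector of the $d$ indices of the chosen levels, encoded by a lossless variable-length binary prefix code. The server decodes the messages and outputs $\hat x\in\mathbb{R}^d$ with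 $\hat x(j)=\frac1n\sum_{i=1}^n(-R+2R\,q_i^j)$. **Corollary.** There are universal constants $c,C>0$ and, for all $d\ge1$ and $k\ge2$, a prefix code on $\{1,\dots,k\}^d$ (depending only on $d$ and $k$) such that for all $n\ge1$, $R>0$ and all inputs $x_1,\dots,x_n$ in the ball $\mathbb{B}^d(R)=\{x\in\mathbb{R}^d:\|x\|_2\le R\}$: the estimator is unbiased, $\mathbb{E}[\hat x]=\bar x$; its mean squared error satisfies $$\mathbb{E}\|\hat x-\bar x\|_2^2\le \frac cn\min\left(\frac{\sqrt d\,\sigma^d_{\mathrm{md}}R}{k},\frac{dR^2}{k^2}\right)+\frac{c^2dR^2}{n^2k^2};$$ and the expected number of bits sent by each client is at most $$C\,d\left(1+\log_2\left(\frac{(k-1)^2}{2d}+1\right)\right)+k\log_2\frac{(k+d)e}{k}+C .$$ -/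

import Mathlib

open MeasureTheory

namespace EntropyCQ

/-! ### Quantization levels in one dimension -/

/-- Spacing `β = (k + 1) / (k (k - 1))` between consecutive levels. -/
noncomputable def spacing (k : ℕ) : ℝ := ((k : ℝ) + 1) / ((k : ℝ) * ((k : ℝ) - 1))

/-- The `k` levels `c₁ + m β`, `m = 0, …, k - 1` (counted from `0`). -/
noncomputable def level (k : ℕ) (c₁ : ℝ) (m : ℕ) : ℝ := c₁ + (m : ℝ) * spacing k

open Classical in
/-- Index of the largest of the `k` levels lying strictly below `y`. -/
noncomputable def lowerIndex (k : ℕ) (c₁ y : ℝ) : ℕ :=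
  Nat.findGreatest (fun m => level k c₁ m < y) (k - 1)

/-- The value `U = p / n + γ` used for rounding. -/
noncomputable def threshold (n p : ℕ) (γ : ℝ) : ℝ := (p : ℝ) / (n : ℝ) + γ

open Classical in
/-- Index of the level to which `y` is rounded with rounding variable `U`: with `c'` the largest
level below `y`, it is the level `c' + β` if `U < (y - c') / β`, and `c'` otherwise. -/
noncomputable def roundIndex (k : ℕ) (c₁ y U : ℝ) : ℕ :=
  lowerIndex k c₁ y +
    if U < (y - level k c₁ (lowerIndex k c₁ y)) / spacing k then 1 else 0

/-- For normalized inputs the rounded value is always one of the `k` levels. -/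
theorem roundIndex_lt {k : ℕ} (hk : 2 ≤ k) {c₁ y : ℝ} (hc : c₁ ∈ Set.Ico (-(1 / (k : ℝ))) 0)
    (hy : y ∈ Set.Icc (0 : ℝ) 1) (U : ℝ) : roundIndex k c₁ y U < k := by
  classical
  have hk2 : (2 : ℝ) ≤ k := by exact_mod_cast hk
  have htop : ¬ level k c₁ (k - 1) < y := by
    have h1 : ((k - 1 : ℕ) : ℝ) = (k : ℝ) - 1 := by
      rw [Nat.cast_sub (by omega)]; simp
    have h2 : ((k : ℝ) - 1) * spacing k = 1 + 1 / k := by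
      have : (k : ℝ) - 1 ≠ 0 := by linarith
      have : (k : ℝ) ≠ 0 := by linarith
      unfold spacing
      field_simp
    unfold level
    rw [h1, h2]
    have h3 := hc.1
    have h4 := hy.2
    linarith
  have hzero : level k c₁ 0 < y := by
    have h3 := hc.2
    have h4 := hy.1
    simp only [level, Nat.cast_zero, zero_mul, add_zero]
    linarith
  have hspec : level k c₁ (lowerIndex k c₁ y) < y :=
    Nat.findGreatest_spec (P := fun m => level k c₁ m < y) (Nat.zero_le _) hzero
  have hle : lowerIndex k c₁ y ≤ k - 1 := Nat.findGreatest_le _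
  have hne : lowerIndex k c₁ y ≠ k - 1 := by
    intro h
    rw [h] at hspec
    exact htop hspec
  unfold roundIndex
  split_ifs <;> omega

/-! ### Randomness

For every coordinate there are a uniformly random permutation `π` of `{0, …, n - 1}` and a uniformly
random first level `c₁ ∈ [-1/k, 0)`, both shared by all clients and the server, and every client
has its own uniformly random `γ ∈ [0, 1/n)`.  All of these are independent. -/

instance permMeasurableSpace (n : ℕ) : MeasurableSpace (Equiv.Perm (Fin n)) := ⊤

/-- Shared randomness: the pair `(π, c₁)` for every coordinate. -/
abbrev PublicSeed (n d : ℕ) : Type := Fin d → Equiv.Perm (Fin n) × ℝ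

/-- Private randomness of one client: the number `γ` for every coordinate. -/
abbrev PrivateSeed (d : ℕ) : Type := Fin d → ℝ

/-- All the randomness of the protocol. -/
abbrev Seed (n d : ℕ) : Type := PublicSeed n d × (Fin n → PrivateSeed d)

/-- Uniform probability measure on the interval `[a, b)`. -/
noncomputable def uniformIco (a b : ℝ) : Measure ℝ :=
  ProbabilityTheory.cond volume (Set.Ico a b)

/-- Law of the shared randomness. -/
noncomputable def publicLaw (n d k : ℕ) : Measure (PublicSeed n d) :=
  Measure.pi fun _ =>
    (ProbabilityTheory.uniformOn (Set.univ : Set (Equiv.Perm (Fin n)))).prod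
      (uniformIco (-(1 / (k : ℝ))) 0)

/-- Law of the private randomness of one client. -/
noncomputable def privateLaw (n d : ℕ) : Measure (PrivateSeed d) :=
  Measure.pi fun _ => uniformIco 0 (1 / (n : ℝ))

/-- Law of all the randomness of the protocol. -/
noncomputable def seedLaw (n d k : ℕ) : Measure (Seed n d) :=
  (publicLaw n d k).prod (Measure.pi fun _ => privateLaw n d)

/-! ### The protocol -/

/-- A lossless binary prefix code for the elements of `α`, with its decoder.  Codewords may have
different lengths. -/
structure PrefixCode (α : Type*) where
  encode : α → List Bool
  decode : List Bool → α
  decode_encode : ∀ a, decode (encode a) = a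
  prefix_free : ∀ a b, encode a <+: encode b → a = b

/-- Normalization `(x - l) / (r - l)` of the range `[l, r] = [-R, R]` of a coordinate to `[0, 1]`. -/
noncomputable def normalize (R x : ℝ) : ℝ := (x - (-R)) / (R - (-R))

/-- Inverse of `normalize`. -/
noncomputable def denormalize (R y : ℝ) : ℝ := -R + (R - (-R)) * y

/-- Quantizer of client `i`: each coordinate of `x` is rounded to one of the `k` levels, given by
its index.  The minimum with `k - 1` only serves to make the definition total: it is never active
for inputs in the ball of radius `R`, see `roundIndex_lt`. -/
noncomputable def quantize {n d : ℕ} (k : ℕ) (hk : 0 < k) (R : ℝ) (i : Fin n)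
    (pub : PublicSeed n d) (priv : PrivateSeed d) (x : EuclideanSpace ℝ (Fin d)) :
    Fin d → Fin k :=
  fun j =>
    ⟨min (roundIndex k (pub j).2 (normalize R (x j))
        (threshold n ((pub j).1 i : ℕ) (priv j))) (k - 1), by omega⟩

/-- The bit string sent by client `i`. -/
noncomputable def message {n d : ℕ} (k : ℕ) (hk : 0 < k) (code : PrefixCode (Fin d → Fin k))
    (R : ℝ) (i : Fin n) (pub : PublicSeed n d) (priv : PrivateSeed d)
    (x : EuclideanSpace ℝ (Fin d)) : List Bool :=
  code.encode (quantize k hk R i pub priv x)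

/-- The server's reading of one message: the vector of the chosen levels in the original scale. -/
noncomputable def reconstruct {n d : ℕ} (k : ℕ) (code : PrefixCode (Fin d → Fin k)) (R : ℝ)
    (pub : PublicSeed n d) (msg : List Bool) : EuclideanSpace ℝ (Fin d) :=
  WithLp.toLp 2 fun j => denormalize R (level k (pub j).2 (code.decode msg j : ℕ))

/-- The server's estimate of the mean, computed from the messages and the shared randomness. -/
noncomputable def serverEstimate {n d : ℕ} (k : ℕ) (code : PrefixCode (Fin d → Fin k)) (R : ℝ)
    (pub : PublicSeed n d) (msgs : Fin n → List Bool) : EuclideanSpace ℝ (Fin d) :=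
  (1 / (n : ℝ)) • ∑ i, reconstruct k code R pub (msgs i)

/-- The estimate output by the whole protocol on the inputs `x`. -/
noncomputable def estimate {n d : ℕ} (k : ℕ) (hk : 0 < k) (code : PrefixCode (Fin d → Fin k))
    (R : ℝ) (x : Fin n → EuclideanSpace ℝ (Fin d)) (ω : Seed n d) : EuclideanSpace ℝ (Fin d) :=
  serverEstimate k code R ω.1 fun i => message k hk code R i ω.1 (ω.2 i) (x i)

/-- Number of bits sent by client `i`. -/
noncomputable def bits {n d : ℕ} (k : ℕ) (hk : 0 < k) (code : PrefixCode (Fin d → Fin k))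
    (R : ℝ) (x : Fin n → EuclideanSpace ℝ (Fin d)) (i : Fin n) (ω : Seed n d) : ℕ :=
  (message k hk code R i ω.1 (ω.2 i) (x i)).length

/-! ### Empirical quantities -/

/-- The mean `x̄` of the inputs. -/
noncomputable def mean {n d : ℕ} (x : Fin n → EuclideanSpace ℝ (Fin d)) :
    EuclideanSpace ℝ (Fin d) :=
  (1 / (n : ℝ)) • ∑ i, x i

/-- The average `ℓ₂` deviation of the inputs from their mean. -/
noncomputable def meanDeviation {n d : ℕ} (x : Fin n → EuclideanSpace ℝ (Fin d)) : ℝ :=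
  (1 / (n : ℝ)) * ∑ i, ‖x i - mean x‖

end EntropyCQ

namespace EntropyCQ

/-! ### The quantizer in one dimension -/

section Quantizer

variable {k : ℕ} {c y : ℝ}

/-! Write β for `spacing k` and u for the `cellPosition` of a normalized coordinate. Rounding gives
the error β(1{U < u} - u) (`level_roundIndex_sub`), so in each coordinate the estimate is off by
2Rβ/n times `coordError`, and the code cancels because its decoder inverts it. As π_i/n + γ_i is
uniform on [0,1), every summand of `coordError` has mean zero: the estimate is unbiased.

For the variance, fix the grid. Given π the rounding decisions are independent, and client i rounds
up with probability `ramp (n u_i - π_i)`. Two clients occupy a uniformly random pair of distinct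
strata, which makes their errors negatively correlated: the covariance is at most (1/(4n) -
(min(u_i,u_l) - u_i u_l))/(n-1) (`permAvg_covariance_le`). Dropping the negative part bounds the
second moment by 1/4 + n/4. Spreading each variance u_i - u_i² over the n-1 other clients and
cancelling it against the covariances leaves 1/4 plus the sum of |u_i - u_l| over ordered pairs,
divided by n-1.

The random shift of the grid then makes u Lipschitz on average: E|u_i - u_l| ≤ 2k|y_i - y_l|
(`integral_abs_cellPosition_sub_le`). Summing over coordinates with Cauchy–Schwarz and comparing
through the mean turns this into √d times the mean deviation. The two second-moment bounds give the
two entries of the minimum.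

The code writes each index as its offset from k/2 in self-delimiting binary. A vector in the ball
has normalized coordinates whose squared distances from 1/2 sum to at most 1/4, so Jensen's
inequality for the logarithm bounds the length (`length_offsetCode_le`). This bound holds almost
surely, not only on average. -/

theorem spacing_pos (hk : 2 ≤ k) : 0 < spacing k := by
  have hk2 : (2 : ℝ) ≤ k := by exact_mod_cast hk
  have : 0 < (k : ℝ) - 1 := by linarith
  unfold spacing
  positivity

theorem spacing_le (hk : 2 ≤ k) : spacing k ≤ 3 / k := by
  have hk2 : (2 : ℝ) ≤ k := by exact_mod_cast hk
  have : 0 < (k : ℝ) - 1 := by linarith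
  unfold spacing
  rw [div_le_div_iff₀ (by positivity) (by positivity)]
  nlinarith

theorem one_le_pred_mul_spacing (hk : 2 ≤ k) : 1 ≤ ((k : ℝ) - 1) * spacing k := by
  have hk2 : (2 : ℝ) ≤ k := by exact_mod_cast hk
  have : 0 < (k : ℝ) - 1 := by linarith
  have h : ((k : ℝ) - 1) * spacing k = 1 + 1 / k := by
    unfold spacing
    field_simp
  rw [h]
  have : (0 : ℝ) ≤ 1 / k := by positivity
  linarith

theorem one_div_le_spacing (hk : 2 ≤ k) : 1 / (k : ℝ) ≤ spacing k := by
  have hk2 : (2 : ℝ) ≤ k := by exact_mod_cast hk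
  have h1 := one_le_pred_mul_spacing hk
  have h2 := spacing_pos hk
  rw [div_le_iff₀ (by positivity)]
  nlinarith

theorem level_top_ge (hk : 2 ≤ k) (hc : c ∈ Set.Ico (-(1 / (k : ℝ))) 0) :
    1 ≤ level k c (k - 1) := by
  have hk2 : (2 : ℝ) ≤ k := by exact_mod_cast hk
  have h1 : ((k - 1 : ℕ) : ℝ) = (k : ℝ) - 1 := by
    rw [Nat.cast_sub (by omega)]; simp
  have h2 : ((k : ℝ) - 1) * spacing k = 1 + 1 / k := by
    have : (k : ℝ) - 1 ≠ 0 := by linarith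
    unfold spacing
    field_simp
  have := hc.1
  unfold level
  rw [h1, h2]
  linarith

theorem level_lowerIndex_lt (hc : c < 0) (hy : 0 ≤ y) :
    level k c (lowerIndex k c y) < y := by
  classical
  -- `Nat.findGreatest` returns 0 when nothing qualifies. Here index 0 does qualify, since c < 0 ≤
  -- y.
  refine Nat.findGreatest_spec (P := fun m => level k c m < y) (Nat.zero_le _) ?_
  simp only [level, Nat.cast_zero, zero_mul, add_zero]
  linarith

theorem le_level_of_lowerIndex_lt {m : ℕ} (h : lowerIndex k c y < m) (hm : m ≤ k - 1) :
    y ≤ level k c m := by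
  classical
  exact not_lt.1 (Nat.findGreatest_is_greatest (P := fun m => level k c m < y) h hm)

theorem lowerIndex_lt (hk : 2 ≤ k) (hc : c ∈ Set.Ico (-(1 / (k : ℝ))) 0)
    (hy : y ∈ Set.Icc (0 : ℝ) 1) : lowerIndex k c y < k - 1 := by
  classical
  have hle : lowerIndex k c y ≤ k - 1 := Nat.findGreatest_le _
  refine lt_of_le_of_ne hle fun h => ?_
  have h1 := level_lowerIndex_lt (k := k) hc.2 hy.1
  rw [h] at h1
  have := level_top_ge hk hc
  have := hy.2
  linarith

/-- Relative position of `y` in the cell of the quantizer that contains it. -/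
noncomputable def cellPosition (k : ℕ) (c y : ℝ) : ℝ :=
  (y - level k c (lowerIndex k c y)) / spacing k

theorem cellPosition_mem_Icc (hk : 2 ≤ k) (hc : c ∈ Set.Ico (-(1 / (k : ℝ))) 0)
    (hy : y ∈ Set.Icc (0 : ℝ) 1) : cellPosition k c y ∈ Set.Icc (0 : ℝ) 1 := by
  have hs := spacing_pos hk
  have h1 := level_lowerIndex_lt (k := k) hc.2 hy.1
  have h2 := lowerIndex_lt hk hc hy
  have h3 := le_level_of_lowerIndex_lt (k := k) (c := c) (y := y) (Nat.lt_succ_self _)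
    (Nat.succ_le_of_lt h2)
  refine ⟨div_nonneg (by linarith) hs.le, ?_⟩
  unfold cellPosition
  rw [div_le_one hs]
  simp only [level, Nat.succ_eq_add_one] at *
  push_cast at h3
  linarith

-- For U uniform on [0,1) the right side is β times a centred Bernoulli variable of parameter u, so
-- the error analysis needs only the cell position.
open Classical in
theorem level_roundIndex_sub (hk : 2 ≤ k) (U : ℝ) :
    level k c (roundIndex k c y U) - y =
      spacing k * ((if U < cellPosition k c y then 1 else 0) - cellPosition k c y) := by
  have hs := (spacing_pos hk).ne'
  have h : spacing k * cellPosition k c y = y - level k c (lowerIndex k c y) := by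
    unfold cellPosition
    field_simp
  rw [mul_sub, h]
  have hr : roundIndex k c y U =
      lowerIndex k c y + if U < cellPosition k c y then 1 else 0 := rfl
  rw [hr]
  simp only [level]
  split_ifs <;> push_cast <;> ring

theorem abs_level_roundIndex_sub_le (hk : 2 ≤ k) (hc : c ∈ Set.Ico (-(1 / (k : ℝ))) 0)
    (hy : y ∈ Set.Icc (0 : ℝ) 1) (U : ℝ) :
    |level k c (roundIndex k c y U) - y| ≤ spacing k := by
  classical
  have hs := spacing_pos hk
  have h := cellPosition_mem_Icc hk hc hy
  rw [level_roundIndex_sub hk, abs_mul, abs_of_pos hs]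
  refine mul_le_of_le_one_right hs.le ?_
  rw [abs_le]
  split_ifs <;> constructor <;> linarith [h.1, h.2]

/-- The chosen level is within β of y, the shift c has size at most 1/k ≤ β, and (k/2)β is within β
of 1/2. These three errors give the 3 after division by β, and 1 ≤ (k-1)β handles the remaining
term. -/
theorem abs_roundIndex_sub_half_le (hk : 2 ≤ k) (hc : c ∈ Set.Ico (-(1 / (k : ℝ))) 0)
    (hy : y ∈ Set.Icc (0 : ℝ) 1) (U : ℝ) :
    |(roundIndex k c y U : ℝ) - ((k / 2 : ℕ) : ℝ)| ≤ 3 + ((k : ℝ) - 1) * |y - 1 / 2| := by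
  have hk2 : (2 : ℝ) ≤ k := by exact_mod_cast hk
  have hs := spacing_pos hk
  have h1 := abs_le.1 (abs_level_roundIndex_sub_le hk hc hy U)
  have h2 := one_div_le_spacing hk
  have h3 := one_le_pred_mul_spacing hk
  have hdiv : (k : ℝ) = 2 * ((k / 2 : ℕ) : ℝ) + ((k % 2 : ℕ) : ℝ) := by
    exact_mod_cast (Nat.div_add_mod k 2).symm
  have hmod : ((k % 2 : ℕ) : ℝ) ≤ 1 := by
    exact_mod_cast Nat.le_of_lt_succ (Nat.mod_lt k (by norm_num))
  have hmod0 : (0 : ℝ) ≤ ((k % 2 : ℕ) : ℝ) := by positivity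
  have hks : (k : ℝ) * spacing k ≤ 1 + 2 * spacing k := by
    have : ((k : ℝ) - 1) * spacing k = 1 + 1 / k := by
      have : (k : ℝ) - 1 ≠ 0 := by linarith
      unfold spacing
      field_simp
    nlinarith
  set m : ℝ := (roundIndex k c y U : ℝ) with hm
  set h : ℝ := ((k / 2 : ℕ) : ℝ) with hh
  have hlev : level k c (roundIndex k c y U) = c + m * spacing k := rfl
  rw [hlev] at h1
  have hc1 := hc.1
  have hc2 := hc.2
  have hA : |m - h| * spacing k ≤ |y - 1 / 2| + 3 * spacing k := by
    rw [← abs_of_pos hs, ← abs_mul, abs_of_pos hs, abs_le]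
    have h4 := neg_abs_le (y - 1 / 2)
    have h5 := le_abs_self (y - 1 / 2)
    have h6 : h * spacing k ≤ 1 / 2 + spacing k := by nlinarith
    have h7 : 1 / 2 - spacing k ≤ h * spacing k := by nlinarith
    constructor <;> linarith [sub_mul m h (spacing k)]
  have hB : |y - 1 / 2| ≤ ((k : ℝ) - 1) * |y - 1 / 2| * spacing k := by
    nlinarith [abs_nonneg (y - 1 / 2)]
  have hC : |m - h| * spacing k ≤ (3 + ((k : ℝ) - 1) * |y - 1 / 2|) * spacing k := by linarith
  exact le_of_mul_le_mul_right hC hs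

end Quantizer

/-! ### A prefix code for vectors of indices close to the middle -/

/-- Self-delimiting encoding of a bit string: every bit is preceded by `true`, and the end is marked
by `false`. -/
def delimit : List Bool → List Bool
  | [] => [false]
  | b :: l => true :: b :: delimit l

theorem length_delimit (l : List Bool) : (delimit l).length = 2 * l.length + 1 := by
  induction l with
  | nil => rfl
  | cons b l ih => simp [delimit, ih]; ring

theorem delimit_append_prefix {l₁ l₂ s₁ s₂ : List Bool}
    (h : delimit l₁ ++ s₁ <+: delimit l₂ ++ s₂) : l₁ = l₂ ∧ s₁ <+: s₂ := by
  induction l₁ generalizing l₂ with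
  | nil =>
    cases l₂ with
    | nil => simpa [delimit] using h
    | cons b l => simp [delimit] at h
  | cons a l ih =>
    cases l₂ with
    | nil => simp [delimit] at h
    | cons b l' =>
      simp only [delimit, List.cons_append, List.cons_prefix_cons, true_and] at h
      obtain ⟨h1, h2⟩ := ih h.2
      exact ⟨by rw [h.1, h1], h2⟩

/-- Blocks are peeled off one at a time. Equal numbers of blocks are needed because the empty
concatenation is a prefix of everything. -/
theorem flatMap_delimit_prefix {α : Type*} {f : α → List Bool} (hf : Function.Injective f)
    {l₁ l₂ : List α} (hlen : l₁.length = l₂.length)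
    (h : l₁.flatMap (fun a => delimit (f a)) <+: l₂.flatMap (fun a => delimit (f a))) :
    l₁ = l₂ := by
  induction l₁ generalizing l₂ with
  | nil => exact (List.length_eq_zero_iff.1 hlen.symm).symm
  | cons a l ih =>
    cases l₂ with
    | nil => simp at hlen
    | cons b l' =>
      simp only [List.flatMap_cons] at h
      obtain ⟨h1, h2⟩ := delimit_append_prefix h
      rw [hf h1, ih (by simpa using hlen) h2]

/-- Sign and binary expansion of the offset of an index from the middle of the range. -/
def offsetBits (k : ℕ) (a : Fin k) : List Bool :=
  decide ((a : ℕ) < k / 2) :: (Nat.dist a (k / 2)).bits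

theorem offsetBits_injective (k : ℕ) : Function.Injective (offsetBits k) := by
  intro a b h
  simp only [offsetBits, List.cons.injEq, decide_eq_decide] at h
  have h2 : Nat.dist a (k / 2) = Nat.dist b (k / 2) := by
    apply Nat.digits.injective 2
    rw [Nat.digits_two_eq_bits, Nat.digits_two_eq_bits, h.2]
  ext
  simp only [Nat.dist] at h2
  have := h.1
  omega

/-- The prefix code that writes one coordinate after another. -/
noncomputable def offsetCode (d k : ℕ) (hk : 0 < k) : PrefixCode (Fin d → Fin k) :=
  haveI : Nonempty (Fin d → Fin k) := ⟨fun _ => ⟨0, hk⟩⟩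
  have hpre : ∀ v w : Fin d → Fin k,
      (List.ofFn v).flatMap (fun a => delimit (offsetBits k a)) <+:
        (List.ofFn w).flatMap (fun a => delimit (offsetBits k a)) → v = w := fun v w h =>
    List.ofFn_injective (flatMap_delimit_prefix (offsetBits_injective k) (by simp) h)
  { encode := fun v => (List.ofFn v).flatMap fun a => delimit (offsetBits k a)
    -- Any left inverse of the encoder will do. Injectivity follows from prefix-freeness, equal
    -- words being prefixes of each other.
    decode := Function.invFun fun v : Fin d → Fin k =>
      (List.ofFn v).flatMap fun a => delimit (offsetBits k a)
    decode_encode := Function.leftInverse_invFun fun v w h =>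
      hpre v w ⟨[], by rw [List.append_nil]; exact h⟩
    prefix_free := hpre }

theorem length_offsetCode (d k : ℕ) (hk : 0 < k) (v : Fin d → Fin k) :
    ((offsetCode d k hk).encode v).length =
      ∑ j, (2 * (Nat.dist (v j) (k / 2)).size + 3) := by
  simp only [offsetCode, List.length_flatMap, length_delimit, offsetBits, List.length_cons,
    ← Nat.size_eq_bits_len, List.map_ofFn, List.sum_ofFn, Function.comp_apply]
  exact Finset.sum_congr rfl fun j _ => by ring

/-! ### Length of the code: logarithms and Jensen's inequality. -/

/-- For m > 0, 2^(size - 1) ≤ m. The square lets Jensen's inequality meet the ℓ₂ constraint of the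
ball, and the added 1 covers m = 0. -/
theorem two_mul_size_le (m : ℕ) : (2 * m.size : ℝ) ≤ 2 + Real.logb 2 (1 + (m : ℝ) ^ 2) := by
  rcases Nat.eq_zero_or_pos m with rfl | hm
  · simp
  have hs : 0 < m.size := Nat.size_pos.2 hm
  have h1 : 2 ^ (m.size - 1) ≤ m := Nat.lt_size.1 (by omega)
  have h2 : ((2 : ℝ) ^ (m.size - 1)) ^ 2 ≤ 1 + (m : ℝ) ^ 2 := by
    have : (2 : ℝ) ^ (m.size - 1) ≤ m := by exact_mod_cast h1
    have : ((2 : ℝ) ^ (m.size - 1)) ^ 2 ≤ (m : ℝ) ^ 2 := by gcongr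
    linarith
  rw [← pow_mul] at h2
  have h3 : (((m.size - 1) * 2 : ℕ) : ℝ) ≤ Real.logb 2 (1 + (m : ℝ) ^ 2) := by
    rw [Real.le_logb_iff_rpow_le (by norm_num) (by positivity), Real.rpow_natCast]
    exact h2
  have h4 : ((m.size - 1 : ℕ) : ℝ) = m.size - 1 := by
    rw [Nat.cast_sub (by omega)]; simp
  push_cast [h4] at h3
  linarith

/-- Jensen's inequality for the binary logarithm. -/
theorem sum_logb_le {d : ℕ} (hd : 1 ≤ d) (a : Fin d → ℝ) (ha : ∀ j, 0 < a j) :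
    ∑ j, Real.logb 2 (a j) ≤ d * Real.logb 2 ((∑ j, a j) / d) := by
  have hd0 : (0 : ℝ) < d := by exact_mod_cast hd
  have h := strictConcaveOn_log_Ioi.concaveOn.le_map_sum (t := Finset.univ)
    (w := fun _ : Fin d => 1 / (d : ℝ)) (p := a) (fun _ _ => by positivity)
    (by simp [hd0.ne']) (fun j _ => ha j)
  simp only [smul_eq_mul, ← Finset.mul_sum] at h
  have hl : (0 : ℝ) < Real.log 2 := Real.log_pos (by norm_num)
  simp only [Real.logb, ← Finset.sum_div, ← mul_div_assoc]
  rw [div_le_div_iff_of_pos_right hl, div_eq_inv_mul _ (d : ℝ), ← one_div]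
  rw [one_div, inv_mul_le_iff₀ hd0] at h
  rw [one_div]
  exact h

/-- In the application t j is the normalized coordinate minus 1/2, and the ball gives the bound 1/4.
Each coordinate costs at most 5 + log₂(1 + offset²) bits, and Jensen's inequality moves the average
inside the logarithm. -/
theorem length_offsetCode_le {d k : ℕ} (hd : 1 ≤ d) (hk : 2 ≤ k) (v : Fin d → Fin k)
    (t : Fin d → ℝ) (ht : ∑ j, t j ^ 2 ≤ 1 / 4)
    (hv : ∀ j, |((v j : ℕ) : ℝ) - ((k / 2 : ℕ) : ℝ)| ≤ 3 + ((k : ℝ) - 1) * |t j|) :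
    (((offsetCode d k (by omega)).encode v).length : ℝ) ≤
      10 * (d * (1 + Real.logb 2 (((k : ℝ) - 1) ^ 2 / (2 * d) + 1))) := by
  have hd0 : (0 : ℝ) < d := by exact_mod_cast hd
  have hcast : ∀ j, ((Nat.dist (v j) (k / 2) : ℕ) : ℝ) ^ 2 =
      (((v j : ℕ) : ℝ) - ((k / 2 : ℕ) : ℝ)) ^ 2 := by
    intro j
    rcases le_total (v j : ℕ) (k / 2) with h | h
    · rw [Nat.dist_eq_sub_of_le h, Nat.cast_sub h]; ring
    · rw [Nat.dist_eq_sub_of_le_right h, Nat.cast_sub h]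
  have hsq : ∀ j, ((Nat.dist (v j) (k / 2) : ℕ) : ℝ) ^ 2 ≤
      18 + 2 * ((k : ℝ) - 1) ^ 2 * t j ^ 2 := by
    intro j
    rw [hcast j, ← sq_abs, ← sq_abs (t j)]
    have h1 := pow_le_pow_left₀ (abs_nonneg _) (hv j) 2
    nlinarith [sq_nonneg (3 - ((k : ℝ) - 1) * |t j|)]
  set Q : ℝ := ((k : ℝ) - 1) ^ 2 / (2 * d) with hQ
  have hQ0 : 0 ≤ Q := by positivity
  -- The average is at most 19 + Q. It is rounded up to 32(Q + 1) so that the logarithm costs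
  -- exactly 5, whence 10 = 5 + 5.
  have hsum : (∑ j, (1 + ((Nat.dist (v j) (k / 2) : ℕ) : ℝ) ^ 2)) / d ≤ 2 ^ 5 * (Q + 1) := by
    have h1 : ∑ j, (1 + ((Nat.dist (v j) (k / 2) : ℕ) : ℝ) ^ 2) ≤
        ∑ j, (19 + 2 * ((k : ℝ) - 1) ^ 2 * t j ^ 2) :=
      Finset.sum_le_sum fun j _ => by linarith [hsq j]
    rw [Finset.sum_add_distrib (f := fun _ => (19 : ℝ)), ← Finset.mul_sum] at h1
    simp only [Finset.sum_const, Finset.card_univ, Fintype.card_fin, nsmul_eq_mul] at h1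
    have h2 : 2 * ((k : ℝ) - 1) ^ 2 * ∑ j, t j ^ 2 ≤ Q * d := by
      have : Q * d = 2 * ((k : ℝ) - 1) ^ 2 * (1 / 4) := by
        rw [hQ]; field_simp; norm_num
      rw [this]
      gcongr
    rw [div_le_iff₀ hd0]
    nlinarith
  have hlog : Real.logb 2 ((∑ j, (1 + ((Nat.dist (v j) (k / 2) : ℕ) : ℝ) ^ 2)) / (d : ℝ)) ≤
      5 + Real.logb 2 (Q + 1) := by
    have hpos : 0 < (∑ j, (1 + ((Nat.dist (v j) (k / 2) : ℕ) : ℝ) ^ 2)) / (d : ℝ) := by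
      have : Nonempty (Fin d) := ⟨⟨0, hd⟩⟩
      exact div_pos (Finset.sum_pos (fun j _ => by positivity) Finset.univ_nonempty) hd0
    have h1 := Real.logb_le_logb_of_le (b := 2) (by norm_num) hpos hsum
    rw [Real.logb_mul (by norm_num) (by positivity), Real.logb_pow,
      Real.logb_self_eq_one (by norm_num)] at h1
    norm_num at h1
    linarith
  have hlog0 : 0 ≤ Real.logb 2 (Q + 1) := Real.logb_nonneg (by norm_num) (by linarith)
  rw [length_offsetCode]
  push_cast
  calc ∑ j, (2 * ((Nat.dist (v j) (k / 2)).size : ℝ) + 3)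
      ≤ ∑ j, (5 + Real.logb 2 (1 + ((Nat.dist (v j) (k / 2) : ℕ) : ℝ) ^ 2)) :=
        Finset.sum_le_sum fun j _ => by linarith [two_mul_size_le (Nat.dist (v j) (k / 2))]
    _ = 5 * d + ∑ j, Real.logb 2 (1 + ((Nat.dist (v j) (k / 2) : ℕ) : ℝ) ^ 2) := by
        rw [Finset.sum_add_distrib]; simp [mul_comm]
    _ ≤ 5 * d + d * (5 + Real.logb 2 (Q + 1)) := by
        gcongr
        exact (sum_logb_le hd _ fun j => by positivity).trans (by gcongr)
    _ ≤ 10 * (d * (1 + Real.logb 2 (Q + 1))) := by nlinarith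

/-! ### Stratified rounding: sums over the strata and over permutations -/

/-- The number `t` clamped to the unit interval. -/
noncomputable def ramp (t : ℝ) : ℝ := max 0 (min 1 t)

theorem ramp_nonneg (t : ℝ) : 0 ≤ ramp t := le_max_left _ _

theorem ramp_mono : Monotone ramp := fun _ _ h => max_le_max le_rfl (min_le_min le_rfl h)

theorem ramp_of_nonpos {t : ℝ} (h : t ≤ 0) : ramp t = 0 :=
  max_eq_left ((min_le_right _ _).trans h)

theorem ramp_of_one_le {t : ℝ} (h : 1 ≤ t) : ramp t = 1 := by
  simp [ramp, min_eq_left h]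

theorem ramp_of_mem {t : ℝ} (h0 : 0 ≤ t) (h1 : t ≤ 1) : ramp t = t := by
  simp [ramp, min_eq_right h1, h0]

theorem sum_ramp {t : ℝ} (ht : 0 ≤ t) (N : ℕ) :
    ∑ s ∈ Finset.range N, ramp (t - s) = min t N := by
  induction N with
  | zero => simp [ht]
  | succ N ih =>
    rw [Finset.sum_range_succ, ih]
    push_cast
    rcases le_total t N with h | h
    · rw [ramp_of_nonpos (by linarith), min_eq_left h, min_eq_left (by linarith), add_zero]
    · rw [min_eq_right h]
      rcases le_total t (N + 1) with h' | h'
      · rw [ramp_of_mem (by linarith) (by linarith), min_eq_left h']; ring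
      · rw [ramp_of_one_le (by linarith), min_eq_right h']

theorem sum_ramp_sq_of_le {t : ℝ} {N : ℕ} (ht : (N : ℝ) ≤ t) :
    ∑ s ∈ Finset.range N, ramp (t - s) ^ 2 = N := by
  rw [Finset.sum_congr rfl (g := fun _ => (1 : ℝ))]
  · simp
  · intro s hs
    have : ((s + 1 : ℕ) : ℝ) ≤ N := by exact_mod_cast Finset.mem_range.1 hs
    push_cast at this
    rw [ramp_of_one_le (by linarith), one_pow]

/-- All strata but one contribute 0 or 1, so squaring changes only the stratum containing t. There
the loss is f - f² ≤ 1/4, with f the fractional part. -/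
theorem sum_ramp_sq_ge {t : ℝ} (ht : 0 ≤ t) (N : ℕ) :
    min t N - 1 / 4 ≤ ∑ s ∈ Finset.range N, ramp (t - s) ^ 2 := by
  induction N with
  | zero => simp [ht]
  | succ N ih =>
    rw [Finset.sum_range_succ]
    push_cast
    rcases le_total t N with h | h
    · rw [min_eq_left h] at ih
      rw [ramp_of_nonpos (by linarith), min_eq_left (by linarith)]
      linarith
    · rw [sum_ramp_sq_of_le h]
      rcases le_total t (N + 1) with h' | h'
      · rw [ramp_of_mem (by linarith) (by linarith), min_eq_left h']
        nlinarith [sq_nonneg (t - N - 1 / 2)]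
      · rw [ramp_of_one_le (by linarith), min_eq_right h']
        linarith

theorem sum_fin_ramp {n : ℕ} {a : ℝ} (ha : a ∈ Set.Icc (0 : ℝ) 1) :
    ∑ s : Fin n, ramp (n * a - (s : ℕ)) = n * a := by
  have hn : (0 : ℝ) ≤ n := by positivity
  rw [Fin.sum_univ_eq_sum_range fun s : ℕ => ramp (n * a - s),
    sum_ramp (mul_nonneg hn ha.1), min_eq_left (mul_le_of_le_one_right hn ha.2)]

/-- By monotonicity both factors dominate the ramp of min(a,b), which reduces the claim to a sum of
squares. -/
theorem sum_fin_ramp_mul_ge {n : ℕ} {a b : ℝ} (ha : a ∈ Set.Icc (0 : ℝ) 1)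
    (hb : b ∈ Set.Icc (0 : ℝ) 1) :
    n * min a b - 1 / 4 ≤ ∑ s : Fin n, ramp (n * a - (s : ℕ)) * ramp (n * b - (s : ℕ)) := by
  have hn : (0 : ℝ) ≤ n := by positivity
  have h := sum_ramp_sq_ge (mul_nonneg hn (le_min ha.1 hb.1)) n
  rw [min_eq_left (mul_le_of_le_one_right hn ((min_le_left a b).trans ha.2)),
    ← Fin.sum_univ_eq_sum_range fun s : ℕ => ramp (n * min a b - s) ^ 2] at h
  refine h.trans (Finset.sum_le_sum fun s _ => ?_)
  rw [sq]
  have h1 : n * min a b ≤ n * a := mul_le_mul_of_nonneg_left (min_le_left _ _) hn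
  have h2 : n * min a b ≤ n * b := mul_le_mul_of_nonneg_left (min_le_right _ _) hn
  exact mul_le_mul (ramp_mono (by linarith)) (ramp_mono (by linarith)) (ramp_nonneg _)
    (ramp_nonneg _)

/-! ### Averages over random permutations. -/

theorem card_mul_sum_perm {n : ℕ} (f : Fin n → ℝ) (i : Fin n) :
    n * ∑ π : Equiv.Perm (Fin n), f (π i) = n.factorial * ∑ s, f s := by
  have h : ∀ i', ∑ π : Equiv.Perm (Fin n), f (π i') = ∑ π : Equiv.Perm (Fin n), f (π i) := by
    intro i'
    refine Fintype.sum_equiv (Equiv.mulRight (Equiv.swap i i')) _ _ fun π => ?_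
    simp
  calc n * ∑ π : Equiv.Perm (Fin n), f (π i)
      = ∑ i', ∑ π : Equiv.Perm (Fin n), f (π i') := by
        rw [Finset.sum_congr rfl fun i' _ => h i']; simp
    _ = ∑ π : Equiv.Perm (Fin n), ∑ s, f s := by
        rw [Finset.sum_comm]
        exact Finset.sum_congr rfl fun π _ => Equiv.sum_comp π f
    _ = n.factorial * ∑ s, f s := by simp [Fintype.card_perm]

/-- Double transitivity of the symmetric group: the outer swap corrects the image of l without
moving i'. -/
theorem exists_perm_pair {α : Type*} [DecidableEq α] {i l i' l' : α} (h : i ≠ l) (h' : i' ≠ l') :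
    ∃ τ : Equiv.Perm α, τ i = i' ∧ τ l = l' := by
  refine ⟨Equiv.swap (Equiv.swap i i' l) l' * Equiv.swap i i', ?_, by simp⟩
  have h1 : i' ≠ Equiv.swap i i' l := fun e => h <| by
    have := congrArg (Equiv.swap i i') e
    simpa using this
  simp [Equiv.swap_apply_of_ne_of_ne h1 h']

/-- By double transitivity the sum is the same for every ordered pair of distinct clients. Adding up
all n(n-1) pairs gives, for each π, the full product of sums minus its diagonal. -/
theorem card_mul_sum_perm_pair {n : ℕ} (f g : Fin n → ℝ) {i l : Fin n} (hil : i ≠ l) :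
    n * (n - 1) * ∑ π : Equiv.Perm (Fin n), f (π i) * g (π l) =
      n.factorial * ((∑ s, f s) * (∑ s, g s) - ∑ s, f s * g s) := by
  have hn : 1 ≤ n := Fin.pos i
  have h : ∀ i' l', i' ≠ l' → ∑ π : Equiv.Perm (Fin n), f (π i') * g (π l') =
      ∑ π : Equiv.Perm (Fin n), f (π i) * g (π l) := by
    intro i' l' h'
    obtain ⟨τ, h1, h2⟩ := exists_perm_pair hil h'
    refine Fintype.sum_equiv (Equiv.mulRight τ) _ _ fun π => ?_
    simp [h1, h2]
  calc n * (n - 1) * ∑ π : Equiv.Perm (Fin n), f (π i) * g (π l)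
      = ∑ i', ∑ l' ∈ Finset.univ.erase i',
          ∑ π : Equiv.Perm (Fin n), f (π i') * g (π l') := by
        rw [Finset.sum_congr rfl fun i' _ => Finset.sum_congr rfl fun l' hl' =>
          h i' l' (Finset.ne_of_mem_erase hl').symm]
        simp [Nat.cast_sub hn, mul_assoc]
    _ = ∑ π : Equiv.Perm (Fin n), ∑ i', ∑ l' ∈ Finset.univ.erase i', f (π i') * g (π l') := by
        rw [Finset.sum_comm]
        exact Finset.sum_congr rfl fun i' _ => Finset.sum_comm
    _ = ∑ π : Equiv.Perm (Fin n), ((∑ s, f s) * (∑ s, g s) - ∑ s, f s * g s) := by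
        refine Finset.sum_congr rfl fun π _ => ?_
        rw [← Equiv.sum_comp π f, ← Equiv.sum_comp π g, ← Equiv.sum_comp π fun s => f s * g s,
          Finset.sum_mul_sum, ← Finset.sum_sub_distrib]
        refine Finset.sum_congr rfl fun i' _ => ?_
        rw [← Finset.add_sum_erase _ _ (Finset.mem_univ i')]
        ring
    _ = n.factorial * ((∑ s, f s) * (∑ s, g s) - ∑ s, f s * g s) := by
        simp [Fintype.card_perm, mul_sub]

/-- The average of `F` over all permutations. -/
noncomputable def permAvg {n : ℕ} (F : Equiv.Perm (Fin n) → ℝ) : ℝ :=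
  (n.factorial : ℝ)⁻¹ * ∑ π, F π

theorem permAvg_ramp {n : ℕ} (i : Fin n) {a : ℝ} (ha : a ∈ Set.Icc (0 : ℝ) 1) :
    permAvg (fun π => ramp (n * a - (π i : ℕ))) = a := by
  have hn : (0 : ℝ) < n := by exact_mod_cast Fin.pos i
  have hf : (0 : ℝ) < n.factorial := by exact_mod_cast n.factorial_pos
  have h := card_mul_sum_perm (fun s : Fin n => ramp (n * a - (s : ℕ))) i
  rw [sum_fin_ramp ha] at h
  have h2 : ∑ π : Equiv.Perm (Fin n), ramp (n * a - (π i : ℕ)) = n.factorial * a :=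
    mul_left_cancel₀ hn.ne' (by rw [h]; ring)
  rw [permAvg, h2, inv_mul_cancel_left₀ hf.ne']

theorem permAvg_const {n : ℕ} (a : ℝ) : permAvg (fun _ : Equiv.Perm (Fin n) => a) = a := by
  have hf : (0 : ℝ) < n.factorial := by exact_mod_cast n.factorial_pos
  simp [permAvg, Fintype.card_perm, inv_mul_cancel_left₀ hf.ne']

theorem permAvg_add {n : ℕ} (F G : Equiv.Perm (Fin n) → ℝ) :
    permAvg (fun π => F π + G π) = permAvg F + permAvg G := by
  simp [permAvg, Finset.sum_add_distrib, mul_add]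

theorem permAvg_mul_left {n : ℕ} (a : ℝ) (F : Equiv.Perm (Fin n) → ℝ) :
    permAvg (fun π => a * F π) = a * permAvg F := by
  simp [permAvg, ← Finset.mul_sum, mul_left_comm]

theorem permAvg_sum {n : ℕ} {ι : Type*} (s : Finset ι) (F : ι → Equiv.Perm (Fin n) → ℝ) :
    permAvg (fun π => ∑ i ∈ s, F i π) = ∑ i ∈ s, permAvg (F i) := by
  simp only [permAvg]
  rw [Finset.sum_comm, Finset.mul_sum]

/-- Rounding two clients with the help of distinct strata is negatively correlated, up to a
discretization error. -/
theorem permAvg_covariance_le {n : ℕ} {i l : Fin n} (hil : i ≠ l) {a b : ℝ}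
    (ha : a ∈ Set.Icc (0 : ℝ) 1) (hb : b ∈ Set.Icc (0 : ℝ) 1) :
    permAvg (fun π => (ramp (n * a - (π i : ℕ)) - a) * (ramp (n * b - (π l : ℕ)) - b)) ≤
      (1 / (4 * n) - (min a b - a * b)) / (n - 1) := by
  have hn2 : 2 ≤ n := by
    have := i.2
    have := l.2
    have : (i : ℕ) ≠ l := fun h => hil (Fin.ext h)
    omega
  have hn : (2 : ℝ) ≤ n := by exact_mod_cast hn2
  have hf : (0 : ℝ) < n.factorial := by exact_mod_cast n.factorial_pos
  have hexp : permAvg (fun π : Equiv.Perm (Fin n) =>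
      (ramp (n * a - (π i : ℕ)) - a) * (ramp (n * b - (π l : ℕ)) - b)) =
      permAvg (fun π => ramp (n * a - (π i : ℕ)) * ramp (n * b - (π l : ℕ))) - a * b := by
    have h1 : (fun π : Equiv.Perm (Fin n) =>
        (ramp (n * a - (π i : ℕ)) - a) * (ramp (n * b - (π l : ℕ)) - b)) =
        fun π => ramp (n * a - (π i : ℕ)) * ramp (n * b - (π l : ℕ)) +
          ((-b) * ramp (n * a - (π i : ℕ)) + ((-a) * ramp (n * b - (π l : ℕ)) + a * b)) := by
      funext π; ring
    rw [h1, permAvg_add, permAvg_add, permAvg_add, permAvg_mul_left, permAvg_mul_left,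
      permAvg_ramp i ha, permAvg_ramp l hb, permAvg_const]
    ring
  have h := card_mul_sum_perm_pair (fun s : Fin n => ramp (n * a - (s : ℕ)))
    (fun s : Fin n => ramp (n * b - (s : ℕ))) hil
  rw [sum_fin_ramp ha, sum_fin_ramp hb] at h
  have hS := sum_fin_ramp_mul_ge (n := n) ha hb
  set S := ∑ s : Fin n, ramp (n * a - (s : ℕ)) * ramp (n * b - (s : ℕ))
  have havg : permAvg (fun π : Equiv.Perm (Fin n) =>
      ramp (n * a - (π i : ℕ)) * ramp (n * b - (π l : ℕ))) =
      (n * a * (n * b) - S) / (n * (n - 1)) := by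
    rw [eq_div_iff (by nlinarith), permAvg, mul_assoc, mul_comm (∑ π, _), h,
      inv_mul_cancel_left₀ hf.ne']
  rw [hexp, havg]
  have hpos : 0 < (n : ℝ) * (n - 1) := by nlinarith
  -- Over the common denominator n(n-1) the claim reduces to the lower bound S ≥ n min(a,b) - 1/4.
  have hrhs : (1 / (4 * (n : ℝ)) - (min a b - a * b)) / (n - 1) =
      (n * a * (n * b) - (n * min a b - 1 / 4)) / (n * (n - 1)) - a * b := by
    have : (n : ℝ) - 1 ≠ 0 := by linarith
    field_simp
    ring
  rw [hrhs]
  gcongr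

/-- Second moment of the rounding error given the permutation `π`. -/
noncomputable def condSecondMoment {n : ℕ} (u : Fin n → ℝ) (π : Equiv.Perm (Fin n)) : ℝ :=
  ∑ i, (ramp (n * u i - (π i : ℕ)) * (1 - 2 * u i) + u i ^ 2) +
    ∑ i, ∑ l ∈ Finset.univ.erase i,
      (ramp (n * u i - (π i : ℕ)) - u i) * (ramp (n * u l - (π l : ℕ)) - u l)

theorem permAvg_condSecondMoment_le_sum {n : ℕ} {u : Fin n → ℝ}
    (hu : ∀ i, u i ∈ Set.Icc (0 : ℝ) 1) :
    permAvg (condSecondMoment u) ≤ ∑ i, (u i - u i ^ 2) +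
      ∑ i, ∑ l ∈ Finset.univ.erase i,
        (1 / (4 * n) - (min (u i) (u l) - u i * u l)) / (n - 1) := by
  have h1 : condSecondMoment u = fun π =>
      ∑ i, (((1 - 2 * u i) * ramp (n * u i - (π i : ℕ)) + u i ^ 2) +
    ∑ l ∈ Finset.univ.erase i,
      (ramp (n * u i - (π i : ℕ)) - u i) * (ramp (n * u l - (π l : ℕ)) - u l)) := by
    funext π
    simp only [condSecondMoment, Finset.sum_add_distrib, mul_comm]
  rw [h1, permAvg_sum, ← Finset.sum_add_distrib]
  refine Finset.sum_le_sum fun i _ => ?_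
  rw [permAvg_add, permAvg_add, permAvg_mul_left, permAvg_ramp i (hu i), permAvg_const,
    permAvg_sum]
  refine add_le_add (le_of_eq (by ring)) (Finset.sum_le_sum fun l hl => ?_)
  exact permAvg_covariance_le (Finset.ne_of_mem_erase hl).symm (hu i) (hu l)

theorem min_sub_mul_nonneg {a b : ℝ} (ha : a ∈ Set.Icc (0 : ℝ) 1) (hb : b ∈ Set.Icc (0 : ℝ) 1) :
    0 ≤ min a b - a * b := by
  rw [sub_nonneg]
  exact le_min (mul_le_of_le_one_right ha.1 hb.2) (mul_le_of_le_one_left hb.1 ha.2)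

/-- The left side is a(b - a) if a ≤ b and (a - b)(1 - a) otherwise. This is the variance left over
after cancellation against one covariance. -/
theorem sub_sq_sub_min_le {a b : ℝ} (ha : a ∈ Set.Icc (0 : ℝ) 1) :
    a - a ^ 2 - (min a b - a * b) ≤ |a - b| := by
  obtain ⟨ha0, ha1⟩ := ha
  rcases le_total a b with h | h
  · rw [min_eq_left h, abs_of_nonpos (by linarith)]
    nlinarith
  · rw [min_eq_right h, abs_of_nonneg (by linarith)]
    nlinarith

theorem permAvg_condSecondMoment_le_card {n : ℕ} {u : Fin n → ℝ} (hn : 1 ≤ n)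
    (hu : ∀ i, u i ∈ Set.Icc (0 : ℝ) 1) :
    permAvg (condSecondMoment u) ≤ 1 / 4 + n / 4 := by
  have hn1 : (1 : ℝ) ≤ n := by exact_mod_cast hn
  refine (permAvg_condSecondMoment_le_sum hu).trans ?_
  have h1 : ∑ i, (u i - u i ^ 2) ≤ n / 4 := by
    calc ∑ i, (u i - u i ^ 2) ≤ ∑ _i : Fin n, (1 / 4 : ℝ) :=
          Finset.sum_le_sum fun i _ => by nlinarith [sq_nonneg (u i - 1 / 2)]
      _ = n / 4 := by simp; ring
  have h2 : ∑ i, ∑ l ∈ Finset.univ.erase i,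
      (1 / (4 * (n : ℝ)) - (min (u i) (u l) - u i * u l)) / (n - 1) ≤ 1 / 4 := by
    calc _ ≤ ∑ i : Fin n, ∑ _l ∈ Finset.univ.erase i, 1 / (4 * (n : ℝ)) / (n - 1) := by
          refine Finset.sum_le_sum fun i _ => Finset.sum_le_sum fun l _ => ?_
          refine div_le_div_of_nonneg_right ?_ (by linarith)
          linarith [min_sub_mul_nonneg (hu i) (hu l)]
      _ = n * ((n - 1) * (1 / (4 * (n : ℝ)) / (n - 1))) := by simp [Nat.cast_sub hn]
      _ ≤ 1 / 4 := by
          -- For n = 1 the quotient by n - 1 is 0 by convention. Otherwise n(n-1) terms of size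
          -- 1/(4n(n-1)) add up to 1/4.
          rcases eq_or_lt_of_le hn1 with h | h
          · rw [← h]; norm_num
          · have : (n : ℝ) - 1 ≠ 0 := by linarith
            exact le_of_eq (by field_simp)
  linarith

theorem permAvg_condSecondMoment_le_dist {n : ℕ} {u : Fin n → ℝ} (hn : 1 ≤ n)
    (hu : ∀ i, u i ∈ Set.Icc (0 : ℝ) 1) :
    permAvg (condSecondMoment u) ≤
      1 / 4 + 1 / (n - 1) * ∑ i, ∑ l ∈ Finset.univ.erase i, |u i - u l| := by
  have hn1 : (1 : ℝ) ≤ n := by exact_mod_cast hn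
  refine (permAvg_condSecondMoment_le_sum hu).trans ?_
  -- A single client has no partner, and its variance u - u² is at most 1/4.
  rcases eq_or_lt_of_le hn with rfl | hn'
  · simp
    nlinarith [sq_nonneg (u 0 - 1 / 2)]
  have hn2 : (0 : ℝ) < n - 1 := by
    have : (1 : ℝ) < n := by exact_mod_cast hn'
    linarith
  -- Both the variance and the constant 1/4 are spread evenly over ordered pairs, so that the
  -- inequality can be checked pair by pair.
  have h1 : ∀ i, u i - u i ^ 2 = ∑ _l ∈ Finset.univ.erase i, (u i - u i ^ 2) / (n - 1) := by
    intro i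
    simp only [Finset.sum_const, Finset.card_erase_of_mem (Finset.mem_univ i), Finset.card_univ,
      Fintype.card_fin, nsmul_eq_mul, Nat.cast_sub hn, Nat.cast_one]
    field_simp
  have h2 : (1 / 4 : ℝ) = ∑ i : Fin n, ∑ _l ∈ Finset.univ.erase i, 1 / (4 * (n : ℝ)) / (n - 1) := by
    simp [Nat.cast_sub hn]
    field_simp
  rw [Finset.sum_congr rfl fun i _ => h1 i, h2, Finset.mul_sum, ← Finset.sum_add_distrib,
    ← Finset.sum_add_distrib]
  refine Finset.sum_le_sum fun i _ => ?_
  rw [Finset.mul_sum, ← Finset.sum_add_distrib, ← Finset.sum_add_distrib]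
  refine Finset.sum_le_sum fun l _ => ?_
  rw [← add_div, div_mul_eq_mul_div, one_mul, ← add_div]
  refine div_le_div_of_nonneg_right ?_ hn2.le
  linarith [sub_sq_sub_min_le (b := u l) (hu i)]

/-! ### Uniform distributions -/

theorem isProbabilityMeasure_uniformIco {a b : ℝ} (h : a < b) :
    IsProbabilityMeasure (uniformIco a b) :=
  ProbabilityTheory.cond_isProbabilityMeasure_of_finite (by simp [h]) (by simp)

theorem ae_uniformIco (a b : ℝ) : ∀ᵐ c ∂uniformIco a b, c ∈ Set.Ico a b :=
  ProbabilityTheory.ae_cond_mem measurableSet_Ico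

theorem uniformIco_real_apply {a b : ℝ} (h : a < b) (t : Set ℝ) :
    (uniformIco a b).real t = (b - a)⁻¹ * volume.real (Set.Ico a b ∩ t) := by
  rw [Measure.real, uniformIco, ProbabilityTheory.cond_apply measurableSet_Ico, ENNReal.toReal_mul,
    Real.volume_Ico, ENNReal.toReal_inv, ENNReal.toReal_ofReal (by linarith)]
  rfl

theorem neg_one_div_lt_zero {k : ℕ} (hk : 0 < k) : -(1 / (k : ℝ)) < 0 := by
  have : (0 : ℝ) < k := by exact_mod_cast hk
  have : 0 < 1 / (k : ℝ) := by positivity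
  linarith

/-- With permutation value s, the threshold is uniform on the stratum [s/n, (s+1)/n). The ramp is
the fraction of that stratum below a. -/
theorem uniformIco_threshold_lt {n : ℕ} (hn : 1 ≤ n) (s : ℕ) (a : ℝ) :
    (uniformIco 0 (1 / (n : ℝ))).real {γ | threshold n s γ < a} = ramp (n * a - s) := by
  have hn0 : (0 : ℝ) < n := by exact_mod_cast hn
  have hset : Set.Ico 0 (1 / (n : ℝ)) ∩ {γ | threshold n s γ < a} =
      Set.Ico 0 (min (1 / (n : ℝ)) (a - s / n)) := by
    ext γ
    simp only [threshold, Set.mem_inter_iff, Set.mem_Ico, Set.mem_ofPred_eq, lt_min_iff, and_assoc,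
      lt_sub_iff_add_lt']
  rw [uniformIco_real_apply (by positivity), hset, Real.volume_real_Ico, sub_zero, sub_zero,
    one_div, inv_inv, mul_max_of_nonneg _ _ hn0.le, mul_min_of_nonneg _ _ hn0.le, mul_zero,
    mul_inv_cancel₀ hn0.ne', mul_sub, mul_div_cancel₀ _ hn0.ne', max_comm]
  rfl

theorem integral_uniformOn_perm {n : ℕ} (F : Equiv.Perm (Fin n) → ℝ) :
    ∫ π, F π ∂(ProbabilityTheory.uniformOn (Set.univ : Set (Equiv.Perm (Fin n)))) = permAvg F := by
  rw [integral_fintype .of_finite, permAvg, Finset.mul_sum]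
  refine Finset.sum_congr rfl fun π _ => ?_
  rw [Measure.real, ProbabilityTheory.uniformOn_univ, Measure.count_singleton]
  simp [Fintype.card_perm]

/-! ### The rounding error for fixed positions in the cells -/

open Classical in
/-- Indicator of the event that a client with `π`-value `p` at position `u` of its cell rounds
up. -/
noncomputable def roundUp (n p : ℕ) (u γ : ℝ) : ℝ := if threshold n p γ < u then 1 else 0

theorem roundUp_sq (n p : ℕ) (u γ : ℝ) : roundUp n p u γ ^ 2 = roundUp n p u γ := by
  unfold roundUp
  split_ifs <;> norm_num

theorem abs_roundUp_sub_le {u : ℝ} (hu : u ∈ Set.Icc (0 : ℝ) 1) (n p : ℕ) (γ : ℝ) :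
    |roundUp n p u γ - u| ≤ 1 := by
  unfold roundUp
  rw [abs_le]
  split_ifs <;> constructor <;> linarith [hu.1, hu.2]

theorem measurable_roundUp (n p : ℕ) (u : ℝ) : Measurable (roundUp n p u) := by
  unfold roundUp threshold
  exact Measurable.ite (measurableSet_lt (by fun_prop) measurable_const) measurable_const
    measurable_const

theorem integrable_roundUp {n : ℕ} (hn : 1 ≤ n) (p : ℕ) (u : ℝ) :
    Integrable (roundUp n p u) (uniformIco 0 (1 / (n : ℝ))) := by
  have hn0 : (0 : ℝ) < n := by exact_mod_cast hn
  have := isProbabilityMeasure_uniformIco (a := 0) (b := 1 / (n : ℝ)) (by positivity)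
  refine Integrable.of_bound (measurable_roundUp n p u).aestronglyMeasurable 1 (.of_forall fun γ => ?_)
  unfold roundUp
  split_ifs <;> norm_num

theorem integral_roundUp {n : ℕ} (hn : 1 ≤ n) (p : ℕ) (u : ℝ) :
    ∫ γ, roundUp n p u γ ∂(uniformIco 0 (1 / (n : ℝ))) = ramp (n * u - p) := by
  classical
  have hm : MeasurableSet {γ | threshold n p γ < u} := by
    unfold threshold
    exact measurableSet_lt (by fun_prop) measurable_const
  rw [← uniformIco_threshold_lt hn, ← integral_indicator_one hm]
  rfl

section FixedPositions

variable {n : ℕ} (π : Equiv.Perm (Fin n)) (u : Fin n → ℝ)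

theorem integral_sum_roundUp_sub (hn : 1 ≤ n) :
    ∫ γ : Fin n → ℝ, ∑ i, (roundUp n (π i) (u i) (γ i) - u i)
        ∂(Measure.pi fun _ => uniformIco 0 (1 / (n : ℝ))) =
      ∑ i, (ramp (n * u i - (π i : ℕ)) - u i) := by
  have hn0 : (0 : ℝ) < n := by exact_mod_cast hn
  have := isProbabilityMeasure_uniformIco (a := 0) (b := 1 / (n : ℝ)) (by positivity)
  have hint : ∀ i, Integrable (fun γ => roundUp n (π i) (u i) γ - u i)
      (uniformIco 0 (1 / (n : ℝ))) := fun i =>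
    (integrable_roundUp hn _ _).sub (integrable_const _)
  have hpi : ∀ i, Integrable (fun γ : Fin n → ℝ => roundUp n (π i) (u i) (γ i) - u i)
      (Measure.pi fun _ => uniformIco 0 (1 / (n : ℝ))) := fun i =>
    integrable_comp_eval (X := fun _ : Fin n => ℝ) (i := i)
      (f := fun γ => roundUp n (π i) (u i) γ - u i) (hint i)
  rw [integral_finsetSum _ fun i _ => hpi i]
  refine Finset.sum_congr rfl fun i _ => ?_
  rw [integral_comp_eval (X := fun _ : Fin n => ℝ) (i := i)
        (f := fun γ => roundUp n (π i) (u i) γ - u i)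
      (hint i).aestronglyMeasurable,
    integral_sub (integrable_roundUp hn _ _) (integrable_const _), integral_roundUp hn,
    integral_const, probReal_univ, one_smul]

/-- With π fixed the γ's are independent, so off-diagonal products factor. On the diagonal an
indicator equals its square, so (X - u)² = X(1 - 2u) + u². -/
theorem integral_sum_roundUp_sub_sq (hn : 1 ≤ n) :
    ∫ γ : Fin n → ℝ, (∑ i, (roundUp n (π i) (u i) (γ i) - u i)) ^ 2
        ∂(Measure.pi fun _ => uniformIco 0 (1 / (n : ℝ))) = condSecondMoment u π := by
  have hn0 : (0 : ℝ) < n := by exact_mod_cast hn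
  have := isProbabilityMeasure_uniformIco (a := 0) (b := 1 / (n : ℝ)) (by positivity)
  set ν := uniformIco 0 (1 / (n : ℝ))
  have hR := fun i => integrable_roundUp hn (π i) (u i)
  have hint : ∀ i, Integrable (fun γ => roundUp n (π i) (u i) γ - u i) ν := fun i =>
    (hR i).sub (integrable_const _)
  have hdiag : ∀ i, Integrable (fun γ => roundUp n (π i) (u i) γ * (1 - 2 * u i) + u i ^ 2) ν :=
    fun i => ((hR i).mul_const _).add (integrable_const _)
  have hpi : ∀ i, Integrable (fun γ : Fin n → ℝ => roundUp n (π i) (u i) (γ i) - u i)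
      (Measure.pi fun _ => ν) := fun i =>
    integrable_comp_eval (X := fun _ : Fin n => ℝ) (i := i)
      (f := fun γ => roundUp n (π i) (u i) γ - u i) (hint i)
  have hpidiag : ∀ i, Integrable (fun γ : Fin n → ℝ =>
      roundUp n (π i) (u i) (γ i) * (1 - 2 * u i) + u i ^ 2) (Measure.pi fun _ => ν) := fun i =>
    integrable_comp_eval (X := fun _ : Fin n => ℝ) (i := i)
      (f := fun γ => roundUp n (π i) (u i) γ * (1 - 2 * u i) + u i ^ 2) (hdiag i)
  have hindep : ∀ i l, i ≠ l → ProbabilityTheory.IndepFun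
      (fun γ : Fin n → ℝ => roundUp n (π i) (u i) (γ i) - u i)
      (fun γ : Fin n → ℝ => roundUp n (π l) (u l) (γ l) - u l) (Measure.pi fun _ => ν) :=
    fun i l hil => (ProbabilityTheory.iIndepFun_pi (μ := fun _ : Fin n => ν)
      (X := fun i γ => roundUp n (π i) (u i) γ - u i)
      fun i => (hint i).aestronglyMeasurable.aemeasurable).indepFun hil
  have hexp : ∀ γ : Fin n → ℝ, (∑ i, (roundUp n (π i) (u i) (γ i) - u i)) ^ 2 =
      ∑ i, (roundUp n (π i) (u i) (γ i) * (1 - 2 * u i) + u i ^ 2) +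
        ∑ i, ∑ l ∈ Finset.univ.erase i,
          (roundUp n (π i) (u i) (γ i) - u i) * (roundUp n (π l) (u l) (γ l) - u l) := by
    intro γ
    rw [sq, Finset.sum_mul_sum, ← Finset.sum_add_distrib]
    refine Finset.sum_congr rfl fun i _ => ?_
    rw [← Finset.add_sum_erase _ _ (Finset.mem_univ i)]
    congr 1
    linear_combination roundUp_sq n (π i) (u i) (γ i)
  have hprod : ∀ i l, i ≠ l → Integrable (fun γ : Fin n → ℝ =>
      (roundUp n (π i) (u i) (γ i) - u i) * (roundUp n (π l) (u l) (γ l) - u l))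
      (Measure.pi fun _ => ν) := fun i l hil =>
    (hindep i l hil).integrable_mul (hpi i) (hpi l)
  simp_rw [hexp]
  have hpair : ∀ i, ∀ l ∈ Finset.univ.erase i, Integrable (fun γ : Fin n → ℝ =>
      (roundUp n (π i) (u i) (γ i) - u i) * (roundUp n (π l) (u l) (γ l) - u l))
      (Measure.pi fun _ => ν) := fun i l hl => hprod i l (Finset.ne_of_mem_erase hl).symm
  rw [integral_add (integrable_finsetSum _ fun i _ => hpidiag i)
      (integrable_finsetSum _ fun i _ => integrable_finsetSum _ (hpair i)),
    integral_finsetSum _ fun i _ => hpidiag i,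
    integral_finsetSum _ fun i _ => integrable_finsetSum _ (hpair i), condSecondMoment]
  have hmean : ∀ i, ∫ γ : Fin n → ℝ, (roundUp n (π i) (u i) (γ i) - u i)
      ∂(Measure.pi fun _ => ν) = ramp (n * u i - (π i : ℕ)) - u i := by
    intro i
    rw [integral_comp_eval (X := fun _ : Fin n => ℝ) (i := i)
        (f := fun γ => roundUp n (π i) (u i) γ - u i)
        (hint i).aestronglyMeasurable,
      integral_sub (hR i) (integrable_const _), integral_roundUp hn,
      integral_const, probReal_univ, one_smul]
  congr 1
  · refine Finset.sum_congr rfl fun i _ => ?_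
    rw [integral_comp_eval (X := fun _ : Fin n => ℝ) (i := i)
        (f := fun γ => roundUp n (π i) (u i) γ * (1 - 2 * u i) + u i ^ 2)
        (hdiag i).aestronglyMeasurable,
      integral_add ((hR i).mul_const _) (integrable_const _), integral_mul_const,
      integral_roundUp hn,
      integral_const, probReal_univ, one_smul]
  · refine Finset.sum_congr rfl fun i _ => ?_
    rw [integral_finsetSum _ (hpair i)]
    refine Finset.sum_congr rfl fun l hl => ?_
    rw [(hindep i l (Finset.ne_of_mem_erase hl).symm).integral_fun_mul_eq_mul_integral
      (hpi i).aestronglyMeasurable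
      (hpi l).aestronglyMeasurable, hmean, hmean]

/-- Needed for `integral_mono_of_nonneg`, which then spares proving integrability in the grid shift.
-/
theorem condSecondMoment_nonneg (hn : 1 ≤ n) : 0 ≤ condSecondMoment u π := by
  rw [← integral_sum_roundUp_sub_sq π u hn]
  exact integral_nonneg fun γ => sq_nonneg _

end FixedPositions

/-! ### The random grid -/

theorem measurable_level (k m : ℕ) : Measurable fun c => level k c m := by
  unfold level
  fun_prop

theorem measurable_lowerIndex (k : ℕ) (y : ℝ) : Measurable fun c => lowerIndex k c y := by
  classical
  unfold lowerIndex
  exact measurable_findGreatest fun m _ =>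
    measurableSet_lt (measurable_level k m) measurable_const

theorem measurable_cellPosition (k : ℕ) (y : ℝ) : Measurable fun c => cellPosition k c y := by
  have h : Measurable fun c => ((lowerIndex k c y : ℕ) : ℝ) :=
    measurable_from_top.comp (measurable_lowerIndex k y)
  unfold cellPosition level
  fun_prop

theorem lowerIndex_mono (k : ℕ) (c : ℝ) : Monotone (lowerIndex k c) := by
  classical
  intro z y h
  exact Nat.findGreatest_mono_left (fun m hm => lt_of_lt_of_le hm h) _

/-- The position changes by (y - z)/β minus the number of levels crossed. Both are nonnegative, so
their sum bounds the absolute difference, and β ≥ 1/k bounds the first by k(y - z). -/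
theorem abs_cellPosition_sub_le {k : ℕ} (hk : 2 ≤ k) {c z y : ℝ}
    (hc : c < 0) (hz : 0 ≤ z) (h : z ≤ y) :
    |cellPosition k c y - cellPosition k c z| ≤ k * (y - z) +
      ∑ m ∈ Finset.range k, Set.indicator {c | level k c m ∈ Set.Ico z y} 1 c := by
  classical
  have hk2 : (2 : ℝ) ≤ k := by exact_mod_cast hk
  have hs := spacing_pos hk
  have hmono := lowerIndex_mono k c h
  have hcell : cellPosition k c y - cellPosition k c z =
      (y - z) / spacing k - ((lowerIndex k c y : ℝ) - lowerIndex k c z) := by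
    unfold cellPosition level
    field_simp
    ring
  have hdiv : (y - z) / spacing k ≤ k * (y - z) := by
    have h1 := one_div_le_spacing hk
    rw [div_le_iff₀ (by positivity)] at h1
    rw [div_le_iff₀ hs]
    nlinarith
  have hcount : (lowerIndex k c y : ℝ) - lowerIndex k c z ≤
      ∑ m ∈ Finset.range k, Set.indicator {c | level k c m ∈ Set.Ico z y} (1 : ℝ → ℝ) c := by
    have hle : lowerIndex k c y ≤ k - 1 := Nat.findGreatest_le _
    calc (lowerIndex k c y : ℝ) - lowerIndex k c z
        = ∑ m ∈ Finset.Ioc (lowerIndex k c z) (lowerIndex k c y), (1 : ℝ) := by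
          simp [Nat.cast_sub hmono]
      _ ≤ ∑ m ∈ Finset.Ioc (lowerIndex k c z) (lowerIndex k c y),
          Set.indicator {c | level k c m ∈ Set.Ico z y} (1 : ℝ → ℝ) c := by
          refine Finset.sum_le_sum fun m hm => ?_
          rw [Finset.mem_Ioc] at hm
          have h1 : z ≤ level k c m := le_level_of_lowerIndex_lt hm.1 (hm.2.trans hle)
          have h2 : level k c m < y := by
            refine lt_of_le_of_lt ?_ (level_lowerIndex_lt (k := k) hc (hz.trans h))
            have : (m : ℝ) ≤ lowerIndex k c y := by exact_mod_cast hm.2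
            unfold level
            nlinarith
          rw [Set.indicator_of_mem (show c ∈ {c | level k c m ∈ Set.Ico z y} from ⟨h1, h2⟩)]
          rfl
      _ ≤ _ := by
          refine Finset.sum_le_sum_of_subset_of_nonneg (fun m hm => ?_) fun m _ _ =>
            Set.indicator_nonneg (fun _ _ => zero_le_one) _
          rw [Finset.mem_Ioc] at hm
          rw [Finset.mem_range]
          omega
  have hpos : 0 ≤ (y - z) / spacing k := div_nonneg (by linarith) hs.le
  have hpos2 : (0 : ℝ) ≤ (lowerIndex k c y : ℝ) - lowerIndex k c z := by
    have : (lowerIndex k c z : ℝ) ≤ lowerIndex k c y := by exact_mod_cast hmono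
    linarith
  have hpos3 : 0 ≤ k * (y - z) := by nlinarith
  rw [hcell, abs_le]
  constructor <;> linarith

/-- As the shift varies, each level sweeps an interval of length 1/k with density k. These intervals
are disjoint because β ≥ 1/k, so their parts inside [z, y) have total length at most y - z. -/
theorem sum_uniformIco_level_mem_le {k : ℕ} (hk : 2 ≤ k) {z y : ℝ} (h : z ≤ y) :
    ∑ m ∈ Finset.range k,
        (uniformIco (-(1 / (k : ℝ))) 0).real {c | level k c m ∈ Set.Ico z y} ≤ k * (y - z) := by
  have hk0 : (0 : ℝ) < k := by exact_mod_cast (by omega : 0 < k)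
  have hterm : ∀ m : ℕ, (uniformIco (-(1 / (k : ℝ))) 0).real {c | level k c m ∈ Set.Ico z y} =
      k * (volume.restrict (Set.Ico z y)).real
        (Set.Ico (m * spacing k - 1 / k) (m * spacing k)) := by
    intro m
    rw [uniformIco_real_apply (neg_one_div_lt_zero (by omega)),
      measureReal_restrict_apply measurableSet_Ico]
    have hset : Set.Ico (-(1 / (k : ℝ))) 0 ∩ {c | level k c m ∈ Set.Ico z y} =
        (fun c => c + m * spacing k) ⁻¹'
          (Set.Ico (m * spacing k - 1 / k) (m * spacing k) ∩ Set.Ico z y) := by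
      ext c
      simp only [level, Set.mem_inter_iff, Set.mem_Ico, Set.mem_ofPred_eq, Set.mem_preimage]
      constructor <;> rintro ⟨⟨_, _⟩, h3⟩ <;> exact ⟨⟨by linarith, by linarith⟩, h3⟩
    rw [hset, Measure.real, measure_preimage_add_right, Measure.real]
    simp
  simp_rw [hterm]
  rw [← Finset.mul_sum]
  refine mul_le_mul_of_nonneg_left ?_ hk0.le
  have hsp := one_div_le_spacing hk
  have hs := spacing_pos hk
  rw [← measureReal_biUnion_finset]
  · refine (measureReal_mono (Set.subset_univ _)).trans ?_
    rw [measureReal_restrict_apply_univ, Real.volume_real_Ico_of_le h]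
  · intro m _ m' _ hne
    have key : ∀ a b : ℕ, a < b → Disjoint
        (Set.Ico ((a : ℝ) * spacing k - 1 / k) (a * spacing k))
        (Set.Ico ((b : ℝ) * spacing k - 1 / k) (b * spacing k)) := by
      intro a b hab
      rw [Set.disjoint_left]
      rintro c ⟨_, h2⟩ ⟨h3, _⟩
      have : (a : ℝ) + 1 ≤ b := by exact_mod_cast hab
      nlinarith
    rcases lt_or_gt_of_ne hne with h' | h'
    · exact key _ _ h'
    · exact (key _ _ h').symm
  · intro m _
    exact measurableSet_Ico

theorem integral_abs_cellPosition_sub_le {k : ℕ} (hk : 2 ≤ k) {z y : ℝ} (hz : 0 ≤ z)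
    (hy : 0 ≤ y) :
    ∫ c, |cellPosition k c y - cellPosition k c z| ∂(uniformIco (-(1 / (k : ℝ))) 0) ≤
      2 * k * |y - z| := by
  wlog h : z ≤ y generalizing z y
  · have := this hy hz (le_of_not_ge h)
    simpa only [abs_sub_comm] using this
  have := isProbabilityMeasure_uniformIco (neg_one_div_lt_zero (k := k) (by omega))
  have hm : ∀ m, MeasurableSet {c | level k c m ∈ Set.Ico z y} := fun m =>
    measurable_level k m measurableSet_Ico
  have hint : ∀ m ∈ Finset.range k, Integrable
      (Set.indicator {c | level k c m ∈ Set.Ico z y} (1 : ℝ → ℝ))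
      (uniformIco (-(1 / (k : ℝ))) 0) := fun m _ =>
    (integrable_const (1 : ℝ)).indicator (hm m)
  calc ∫ c, |cellPosition k c y - cellPosition k c z| ∂(uniformIco (-(1 / (k : ℝ))) 0)
      ≤ ∫ c, (k * (y - z) +
          ∑ m ∈ Finset.range k, Set.indicator {c | level k c m ∈ Set.Ico z y} 1 c)
          ∂(uniformIco (-(1 / (k : ℝ))) 0) := by
        refine integral_mono_of_nonneg (.of_forall fun c => abs_nonneg _)
          ((integrable_const _).add (integrable_finsetSum _ hint)) ?_
        filter_upwards [ae_uniformIco (-(1 / (k : ℝ))) 0] with c hc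
        exact abs_cellPosition_sub_le hk hc.2 hz h
    _ = k * (y - z) + ∑ m ∈ Finset.range k,
          (uniformIco (-(1 / (k : ℝ))) 0).real {c | level k c m ∈ Set.Ico z y} := by
        rw [integral_add (integrable_const _) (integrable_finsetSum _ hint),
          integral_finsetSum _ hint]
        congr 1
        · rw [integral_const, probReal_univ, one_smul]
        · exact Finset.sum_congr rfl fun m _ => integral_indicator_one (hm m)
    _ ≤ k * (y - z) + k * (y - z) := by
        gcongr
        exact sum_uniformIco_level_mem_le hk h
    _ = 2 * k * |y - z| := by rw [abs_of_nonneg (by linarith)]; ring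

/-! ### The rounding error in one coordinate -/

/-- The randomness used in one coordinate. -/
noncomputable def coordLaw (n k : ℕ) : Measure ((Equiv.Perm (Fin n) × ℝ) × (Fin n → ℝ)) :=
  ((ProbabilityTheory.uniformOn (Set.univ : Set (Equiv.Perm (Fin n)))).prod
    (uniformIco (-(1 / (k : ℝ))) 0)).prod (Measure.pi fun _ => uniformIco 0 (1 / (n : ℝ)))

/-- Sum of the clients' rounding errors in one coordinate, in units of the level spacing. -/
noncomputable def coordError {n : ℕ} (k : ℕ) (y : Fin n → ℝ)
    (ω : (Equiv.Perm (Fin n) × ℝ) × (Fin n → ℝ)) : ℝ :=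
  ∑ i, (roundUp n (ω.1.1 i) (cellPosition k ω.1.2 (y i)) (ω.2 i) - cellPosition k ω.1.2 (y i))

theorem measurable_coordError {n : ℕ} (k : ℕ) (y : Fin n → ℝ) : Measurable (coordError k y) := by
  classical
  unfold coordError
  refine Finset.measurable_sum _ fun i _ => ?_
  have h1 : Measurable fun ω : (Equiv.Perm (Fin n) × ℝ) × (Fin n → ℝ) =>
      cellPosition k ω.1.2 (y i) :=
    (measurable_cellPosition k (y i)).comp (by fun_prop)
  have h2 : Measurable fun ω : (Equiv.Perm (Fin n) × ℝ) × (Fin n → ℝ) =>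
      (((ω.1.1 i : Fin n) : ℕ) : ℝ) :=
    (measurable_from_top (f := fun π : Equiv.Perm (Fin n) => (((π i : Fin n) : ℕ) : ℝ))).comp
      (by fun_prop)
  refine Measurable.sub ?_ h1
  unfold roundUp threshold
  exact Measurable.ite (measurableSet_lt (by fun_prop) h1) measurable_const measurable_const

section Coordinate

variable {n k : ℕ} {y : Fin n → ℝ}

theorem isProbabilityMeasure_coordLaw (hn : 1 ≤ n) (hk : 2 ≤ k) :
    IsProbabilityMeasure (coordLaw n k) := by
  have hn0 : (0 : ℝ) < n := by exact_mod_cast hn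
  have := isProbabilityMeasure_uniformIco (a := 0) (b := 1 / (n : ℝ)) (by positivity)
  have := isProbabilityMeasure_uniformIco (neg_one_div_lt_zero (k := k) (by omega))
  unfold coordLaw
  infer_instance

theorem ae_coordLaw (hn : 1 ≤ n) (hk : 2 ≤ k) :
    ∀ᵐ ω ∂coordLaw n k, ω.1.2 ∈ Set.Ico (-(1 / (k : ℝ))) 0 := by
  have hn0 : (0 : ℝ) < n := by exact_mod_cast hn
  have := isProbabilityMeasure_uniformIco (a := 0) (b := 1 / (n : ℝ)) (by positivity)
  have := isProbabilityMeasure_uniformIco (neg_one_div_lt_zero (k := k) (by omega))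
  exact Measure.quasiMeasurePreserving_fst.ae
    (Measure.quasiMeasurePreserving_snd.ae (ae_uniformIco (-(1 / (k : ℝ))) 0))

theorem ae_abs_coordError_le (hn : 1 ≤ n) (hk : 2 ≤ k) (hy : ∀ i, y i ∈ Set.Icc (0 : ℝ) 1) :
    ∀ᵐ ω ∂coordLaw n k, |coordError k y ω| ≤ n := by
  filter_upwards [ae_coordLaw hn hk] with ω hω
  refine (Finset.abs_sum_le_sum_abs _ _).trans ?_
  calc _ ≤ ∑ _i : Fin n, (1 : ℝ) := Finset.sum_le_sum fun i _ =>
        abs_roundUp_sub_le (cellPosition_mem_Icc hk hω (hy i)) _ _ _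
    _ = n := by simp

theorem integrable_coordError (hn : 1 ≤ n) (hk : 2 ≤ k) (hy : ∀ i, y i ∈ Set.Icc (0 : ℝ) 1) :
    Integrable (coordError k y) (coordLaw n k) := by
  have := isProbabilityMeasure_coordLaw hn hk
  exact Integrable.of_bound (measurable_coordError k y).aestronglyMeasurable n
    (ae_abs_coordError_le hn hk hy)

theorem integrable_coordError_sq (hn : 1 ≤ n) (hk : 2 ≤ k) (hy : ∀ i, y i ∈ Set.Icc (0 : ℝ) 1) :
    Integrable (fun ω => coordError k y ω ^ 2) (coordLaw n k) := by
  have := isProbabilityMeasure_coordLaw hn hk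
  refine Integrable.of_bound ((measurable_coordError k y).pow_const 2).aestronglyMeasurable
    ((n : ℝ) ^ 2) ?_
  filter_upwards [ae_abs_coordError_le hn hk hy] with ω hω
  rw [Real.norm_eq_abs, abs_pow]
  exact pow_le_pow_left₀ (abs_nonneg _) hω 2

/-- Fubini's theorem for the randomness of one coordinate. -/
theorem integral_coordLaw (hn : 1 ≤ n) (hk : 2 ≤ k)
    {f : (Equiv.Perm (Fin n) × ℝ) × (Fin n → ℝ) → ℝ} (hf : Integrable f (coordLaw n k)) :
    ∫ ω, f ω ∂coordLaw n k = ∫ c, permAvg (fun π =>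
        ∫ γ, f ((π, c), γ) ∂(Measure.pi fun _ => uniformIco 0 (1 / (n : ℝ))))
      ∂(uniformIco (-(1 / (k : ℝ))) 0) := by
  have hn0 : (0 : ℝ) < n := by exact_mod_cast hn
  have := isProbabilityMeasure_uniformIco (a := 0) (b := 1 / (n : ℝ)) (by positivity)
  have := isProbabilityMeasure_uniformIco (neg_one_div_lt_zero (k := k) (by omega))
  unfold coordLaw at hf ⊢
  -- The symmetric form keeps the shift outermost, so that permutations are averaged on a fixed
  -- grid.
  rw [integral_prod _ hf, integral_prod_symm _ hf.integral_prod_left]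
  simp_rw [integral_uniformOn_perm]

theorem integral_coordError (hn : 1 ≤ n) (hk : 2 ≤ k) (hy : ∀ i, y i ∈ Set.Icc (0 : ℝ) 1) :
    ∫ ω, coordError k y ω ∂coordLaw n k = 0 := by
  rw [integral_coordLaw hn hk (integrable_coordError hn hk hy)]
  refine integral_eq_zero_of_ae ?_
  filter_upwards [ae_uniformIco (-(1 / (k : ℝ))) 0] with c hc
  simp only [coordError, integral_sum_roundUp_sub _ _ hn]
  rw [permAvg_sum]
  refine Finset.sum_eq_zero fun i _ => ?_
  simp only [sub_eq_add_neg]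
  rw [permAvg_add, permAvg_const, ← sub_eq_add_neg]
  have := permAvg_ramp i (cellPosition_mem_Icc hk hc (hy i))
  simp only [sub_eq_add_neg] at this
  rw [this]
  simp

theorem integral_coordError_sq (hn : 1 ≤ n) (hk : 2 ≤ k) (hy : ∀ i, y i ∈ Set.Icc (0 : ℝ) 1) :
    ∫ ω, coordError k y ω ^ 2 ∂coordLaw n k =
      ∫ c, permAvg (condSecondMoment fun i => cellPosition k c (y i))
        ∂(uniformIco (-(1 / (k : ℝ))) 0) := by
  rw [integral_coordLaw hn hk (integrable_coordError_sq hn hk hy)]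
  simp only [coordError, integral_sum_roundUp_sub_sq _ _ hn]

theorem permAvg_condSecondMoment_nonneg (hn : 1 ≤ n) (u : Fin n → ℝ) :
    0 ≤ permAvg (condSecondMoment u) :=
  mul_nonneg (by positivity) (Finset.sum_nonneg fun π _ => condSecondMoment_nonneg π u hn)

theorem integral_coordError_sq_le_card (hn : 1 ≤ n) (hk : 2 ≤ k)
    (hy : ∀ i, y i ∈ Set.Icc (0 : ℝ) 1) :
    ∫ ω, coordError k y ω ^ 2 ∂coordLaw n k ≤ 1 / 4 + n / 4 := by
  have := isProbabilityMeasure_uniformIco (neg_one_div_lt_zero (k := k) (by omega))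
  rw [integral_coordError_sq hn hk hy]
  refine (integral_mono_of_nonneg (.of_forall fun c => permAvg_condSecondMoment_nonneg hn _)
    (integrable_const (1 / 4 + n / 4 : ℝ)) ?_).trans
      (by rw [integral_const, probReal_univ, one_smul])
  filter_upwards [ae_uniformIco (-(1 / (k : ℝ))) 0] with c hc
  exact permAvg_condSecondMoment_le_card hn fun i => cellPosition_mem_Icc hk hc (hy i)

theorem integrable_abs_cellPosition_sub (hk : 2 ≤ k) {a b : ℝ} (ha : a ∈ Set.Icc (0 : ℝ) 1)
    (hb : b ∈ Set.Icc (0 : ℝ) 1) :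
    Integrable (fun c => |cellPosition k c a - cellPosition k c b|)
      (uniformIco (-(1 / (k : ℝ))) 0) := by
  have := isProbabilityMeasure_uniformIco (neg_one_div_lt_zero (k := k) (by omega))
  refine (Integrable.of_bound ((measurable_cellPosition k a).sub
    (measurable_cellPosition k b)).aestronglyMeasurable 1 ?_).abs
  filter_upwards [ae_uniformIco (-(1 / (k : ℝ))) 0] with c hc
  have h1 := cellPosition_mem_Icc hk hc ha
  have h2 := cellPosition_mem_Icc hk hc hb
  rw [Pi.sub_apply, Real.norm_eq_abs, abs_le]
  constructor <;> linarith [h1.1, h1.2, h2.1, h2.2]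

theorem integral_coordError_sq_le_dist (hn : 1 ≤ n) (hk : 2 ≤ k)
    (hy : ∀ i, y i ∈ Set.Icc (0 : ℝ) 1) :
    ∫ ω, coordError k y ω ^ 2 ∂coordLaw n k ≤
      1 / 4 + 2 * k * (1 / (n - 1) * ∑ i, ∑ l ∈ Finset.univ.erase i, |y i - y l|) := by
  have := isProbabilityMeasure_uniformIco (neg_one_div_lt_zero (k := k) (by omega))
  have hn1 : (1 : ℝ) ≤ n := by exact_mod_cast hn
  have hint : ∀ i l, Integrable (fun c => |cellPosition k c (y i) - cellPosition k c (y l)|)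
      (uniformIco (-(1 / (k : ℝ))) 0) := fun i l =>
    integrable_abs_cellPosition_sub hk (hy i) (hy l)
  have hsum : ∀ i, Integrable (fun c => ∑ l ∈ Finset.univ.erase i,
      |cellPosition k c (y i) - cellPosition k c (y l)|) (uniformIco (-(1 / (k : ℝ))) 0) :=
    fun i => integrable_finsetSum _ fun l _ => hint i l
  have hsum2 : Integrable (fun c => 1 / ((n : ℝ) - 1) * ∑ i, ∑ l ∈ Finset.univ.erase i,
      |cellPosition k c (y i) - cellPosition k c (y l)|) (uniformIco (-(1 / (k : ℝ))) 0) :=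
    (integrable_finsetSum _ fun i _ => hsum i).const_mul _
  rw [integral_coordError_sq hn hk hy]
  refine (integral_mono_of_nonneg (.of_forall fun c => permAvg_condSecondMoment_nonneg hn _)
    ((integrable_const (1 / 4 : ℝ)).add hsum2) ?_).trans ?_
  · filter_upwards [ae_uniformIco (-(1 / (k : ℝ))) 0] with c hc
    exact permAvg_condSecondMoment_le_dist hn fun i => cellPosition_mem_Icc hk hc (hy i)
  · simp only [Pi.add_apply]
    rw [integral_add (integrable_const _) hsum2, integral_const_mul, integral_const,
      probReal_univ, one_smul, integral_finsetSum _ fun i _ => hsum i, mul_left_comm (2 * (k : ℝ)),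
      Finset.mul_sum _ _ (2 * (k : ℝ))]
    have hinv : 0 ≤ 1 / ((n : ℝ) - 1) := div_nonneg zero_le_one (by linarith)
    refine add_le_add le_rfl (mul_le_mul_of_nonneg_left (Finset.sum_le_sum fun i _ => ?_) hinv)
    rw [integral_finsetSum _ fun l _ => hint i l, Finset.mul_sum]
    exact Finset.sum_le_sum fun l _ =>
      integral_abs_cellPosition_sub_le hk (hy l).1 (hy i).1

end Coordinate

/-! ### From the whole protocol to one coordinate -/

section Protocol

variable {n d k : ℕ} {R : ℝ} {x : Fin n → EuclideanSpace ℝ (Fin d)}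

/-- The randomness of coordinate `j`. -/
def coordSeed (j : Fin d) (ω : Seed n d) : (Equiv.Perm (Fin n) × ℝ) × (Fin n → ℝ) :=
  (ω.1 j, fun i => ω.2 i j)

/-- The squared norm is a sum over coordinates, so its expectation depends only on these marginals.
-/
theorem measurePreserving_coordSeed (hn : 1 ≤ n) (hk : 2 ≤ k) (j : Fin d) :
    MeasurePreserving (coordSeed j) (seedLaw n d k) (coordLaw n k) := by
  have hn0 : (0 : ℝ) < n := by exact_mod_cast hn
  have := isProbabilityMeasure_uniformIco (a := 0) (b := 1 / (n : ℝ)) (by positivity)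
  have := isProbabilityMeasure_uniformIco (neg_one_div_lt_zero (k := k) (by omega))
  unfold seedLaw coordLaw publicLaw privateLaw
  exact (measurePreserving_eval _ j).prod
    (measurePreserving_pi _ _ fun _ => measurePreserving_eval _ j)

theorem isProbabilityMeasure_seedLaw (hn : 1 ≤ n) (hk : 2 ≤ k) :
    IsProbabilityMeasure (seedLaw n d k) := by
  have hn0 : (0 : ℝ) < n := by exact_mod_cast hn
  have := isProbabilityMeasure_uniformIco (a := 0) (b := 1 / (n : ℝ)) (by positivity)
  have := isProbabilityMeasure_uniformIco (neg_one_div_lt_zero (k := k) (by omega))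
  unfold seedLaw publicLaw privateLaw
  infer_instance

theorem ae_seedLaw (hn : 1 ≤ n) (hk : 2 ≤ k) :
    ∀ᵐ ω ∂seedLaw n d k, ∀ j, (ω.1 j).2 ∈ Set.Ico (-(1 / (k : ℝ))) 0 :=
  ae_all_iff.2 fun j =>
    (measurePreserving_coordSeed hn hk j).quasiMeasurePreserving.ae (ae_coordLaw hn hk)

theorem abs_coord_le (hx : ∀ i, ‖x i‖ ≤ R) (i : Fin n) (j : Fin d) : |x i j| ≤ R :=
  (PiLp.norm_apply_le (x i) j).trans (hx i)

theorem normalize_mem_Icc (hR : 0 < R) {t : ℝ} (ht : |t| ≤ R) :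
    normalize R t ∈ Set.Icc (0 : ℝ) 1 := by
  have := abs_le.1 ht
  unfold normalize
  exact ⟨div_nonneg (by linarith) (by linarith), (div_le_one (by linarith)).2 (by linarith)⟩

theorem quantize_val (hk : 2 ≤ k) (hR : 0 < R) (hx : ∀ i, ‖x i‖ ≤ R) {pub : PublicSeed n d}
    (priv : PrivateSeed d) (i : Fin n) {j : Fin d} (hc : (pub j).2 ∈ Set.Ico (-(1 / (k : ℝ))) 0) :
    (quantize k (by omega) R i pub priv (x i) j : ℕ) =
      roundIndex k (pub j).2 (normalize R (x i j)) (threshold n ((pub j).1 i : ℕ) (priv j)) := by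
  have h := roundIndex_lt hk hc (normalize_mem_Icc hR (abs_coord_le hx i j))
    (threshold n ((pub j).1 i : ℕ) (priv j))
  exact min_eq_left (by omega)

theorem estimate_apply_sub_mean (hk : 2 ≤ k) (code : PrefixCode (Fin d → Fin k)) (hR : 0 < R)
    (hx : ∀ i, ‖x i‖ ≤ R) {ω : Seed n d} {j : Fin d}
    (hc : (ω.1 j).2 ∈ Set.Ico (-(1 / (k : ℝ))) 0) :
    estimate k (by omega) code R x ω j - mean x j =
      2 * R * spacing k / n * coordError k (fun i => normalize R (x i j)) (coordSeed j ω) := by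
  have hterm : ∀ i, denormalize R (level k (ω.1 j).2
      (roundIndex k (ω.1 j).2 (normalize R (x i j)) (threshold n ((ω.1 j).1 i : ℕ) (ω.2 i j)))) -
        x i j = 2 * R * spacing k * (roundUp n ((ω.1 j).1 i)
          (cellPosition k (ω.1 j).2 (normalize R (x i j))) (ω.2 i j) -
            cellPosition k (ω.1 j).2 (normalize R (x i j))) := by
    intro i
    have h : level k (ω.1 j).2 (roundIndex k (ω.1 j).2 (normalize R (x i j))
        (threshold n ((ω.1 j).1 i : ℕ) (ω.2 i j))) - normalize R (x i j) =
        spacing k * (roundUp n ((ω.1 j).1 i)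
          (cellPosition k (ω.1 j).2 (normalize R (x i j))) (ω.2 i j) -
            cellPosition k (ω.1 j).2 (normalize R (x i j))) := level_roundIndex_sub hk _
    have hxn : x i j = -R + 2 * R * normalize R (x i j) := by
      unfold normalize
      field_simp
      ring
    unfold denormalize
    linear_combination 2 * R * h - hxn
  simp only [estimate, serverEstimate, mean, reconstruct, message, PiLp.smul_apply, smul_eq_mul,
    code.decode_encode, WithLp.ofLp_sum, Finset.sum_apply, coordError, coordSeed]
  rw [← mul_sub, ← Finset.sum_sub_distrib, Finset.mul_sum, Finset.mul_sum]
  refine Finset.sum_congr rfl fun i _ => ?_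
  rw [quantize_val hk hR hx (ω.2 i) i hc, hterm i]
  ring

end Protocol

section Bounds

variable {n d k : ℕ} {R : ℝ} {x : Fin n → EuclideanSpace ℝ (Fin d)}

theorem ae_estimate_apply (hn : 1 ≤ n) (hk : 2 ≤ k) (code : PrefixCode (Fin d → Fin k))
    (hR : 0 < R) (hx : ∀ i, ‖x i‖ ≤ R) :
    ∀ᵐ ω ∂seedLaw n d k, ∀ j, estimate k (by omega) code R x ω j - mean x j =
      2 * R * spacing k / n * coordError k (fun i => normalize R (x i j)) (coordSeed j ω) := by
  filter_upwards [ae_seedLaw hn hk] with ω hω j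
  exact estimate_apply_sub_mean hk code hR hx (hω j)

/-! ### Unbiasedness -/

theorem integrable_estimate_apply (hn : 1 ≤ n) (hk : 2 ≤ k) (code : PrefixCode (Fin d → Fin k))
    (hR : 0 < R) (hx : ∀ i, ‖x i‖ ≤ R) (j : Fin d) :
    Integrable (fun ω => estimate k (by omega) code R x ω j) (seedLaw n d k) ∧
      ∫ ω, estimate k (by omega) code R x ω j ∂seedLaw n d k = mean x j := by
  have := isProbabilityMeasure_seedLaw (d := d) hn hk
  have hmp := measurePreserving_coordSeed hn hk j
  have hy : ∀ i, normalize R (x i j) ∈ Set.Icc (0 : ℝ) 1 := fun i =>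
    normalize_mem_Icc hR (abs_coord_le hx i j)
  have herr := integrable_coordError hn hk hy
  have herr' : Integrable (fun ω => coordError k (fun i => normalize R (x i j)) (coordSeed j ω))
      (seedLaw n d k) := hmp.integrable_comp_of_integrable herr
  have hae : (fun ω => estimate k (by omega) code R x ω j) =ᵐ[seedLaw n d k] fun ω =>
      mean x j + 2 * R * spacing k / n *
        coordError k (fun i => normalize R (x i j)) (coordSeed j ω) := by
    filter_upwards [ae_estimate_apply hn hk code hR hx] with ω hω
    rw [← hω j]
    ring
  refine ⟨((integrable_const _).add (herr'.const_mul _)).congr hae.symm, ?_⟩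
  rw [integral_congr_ae hae, integral_add (integrable_const _) (herr'.const_mul _),
    integral_const_mul]
  have hzero : ∫ ω, coordError k (fun i => normalize R (x i j)) (coordSeed j ω)
      ∂seedLaw n d k = 0 := by
    rw [← integral_coordError hn hk hy, ← hmp.map_eq,
      integral_map hmp.measurable.aemeasurable (measurable_coordError k _).aestronglyMeasurable]
  rw [hzero]
  simp

theorem integrable_estimate (hn : 1 ≤ n) (hk : 2 ≤ k) (code : PrefixCode (Fin d → Fin k))
    (hR : 0 < R) (hx : ∀ i, ‖x i‖ ≤ R) :
    Integrable (estimate k (by omega) code R x) (seedLaw n d k) :=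
  Integrable.of_eval_piLp fun j => (integrable_estimate_apply hn hk code hR hx j).1

theorem integral_estimate (hn : 1 ≤ n) (hk : 2 ≤ k) (code : PrefixCode (Fin d → Fin k))
    (hR : 0 < R) (hx : ∀ i, ‖x i‖ ≤ R) :
    ∫ ω, estimate k (by omega) code R x ω ∂seedLaw n d k = mean x := by
  ext j
  rw [eval_integral_piLp fun j => (integrable_estimate_apply hn hk code hR hx j).1]
  exact (integrable_estimate_apply hn hk code hR hx j).2

/-! ### Mean squared error -/

theorem ae_norm_sq_error (hn : 1 ≤ n) (hk : 2 ≤ k) (code : PrefixCode (Fin d → Fin k))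
    (hR : 0 < R) (hx : ∀ i, ‖x i‖ ≤ R) :
    (fun ω => ‖estimate k (by omega) code R x ω - mean x‖ ^ 2) =ᵐ[seedLaw n d k] fun ω =>
      (2 * R * spacing k / n) ^ 2 *
        ∑ j, coordError k (fun i => normalize R (x i j)) (coordSeed j ω) ^ 2 := by
  filter_upwards [ae_estimate_apply hn hk code hR hx] with ω hω
  rw [EuclideanSpace.real_norm_sq_eq, Finset.mul_sum]
  refine Finset.sum_congr rfl fun j _ => ?_
  rw [PiLp.sub_apply, hω j, mul_pow]

theorem integrable_norm_sq_error (hn : 1 ≤ n) (hk : 2 ≤ k) (code : PrefixCode (Fin d → Fin k))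
    (hR : 0 < R) (hx : ∀ i, ‖x i‖ ≤ R) :
    Integrable (fun ω => ‖estimate k (by omega) code R x ω - mean x‖ ^ 2) (seedLaw n d k) ∧
      ∫ ω, ‖estimate k (by omega) code R x ω - mean x‖ ^ 2 ∂seedLaw n d k =
        (2 * R * spacing k / n) ^ 2 *
          ∑ j, ∫ ω, coordError k (fun i => normalize R (x i j)) ω ^ 2 ∂coordLaw n k := by
  have hae := ae_norm_sq_error hn hk code hR hx
  have hsq : ∀ j : Fin d, Integrable (fun ω : Seed n d =>
      coordError k (fun i => normalize R (x i j)) (coordSeed j ω) ^ 2) (seedLaw n d k) := fun j =>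
    (measurePreserving_coordSeed hn hk j).integrable_comp_of_integrable
      (integrable_coordError_sq hn hk fun i => normalize_mem_Icc hR (abs_coord_le hx i j))
  refine ⟨((integrable_finsetSum _ fun j _ => hsq j).const_mul _).congr hae.symm, ?_⟩
  rw [integral_congr_ae hae, integral_const_mul, integral_finsetSum _ fun j _ => hsq j]
  congr 1
  refine Finset.sum_congr rfl fun j _ => ?_
  have hmp := measurePreserving_coordSeed (d := d) hn hk j
  rw [← hmp.map_eq, integral_map hmp.measurable.aemeasurable
    ((measurable_coordError k _).pow_const 2).aestronglyMeasurable]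

theorem sum_abs_le_sqrt_mul_norm (v : EuclideanSpace ℝ (Fin d)) : ∑ j, |v j| ≤ √d * ‖v‖ := by
  have h := sq_sum_le_card_mul_sum_sq (s := Finset.univ) (f := fun j => |v j|)
  simp only [sq_abs, Finset.card_univ, Fintype.card_fin] at h
  rw [← EuclideanSpace.real_norm_sq_eq] at h
  refine le_of_sq_le_sq ?_ (by positivity)
  rw [mul_pow, Real.sq_sqrt (by positivity)]
  exact h

/-- Comparing through the mean, each deviation occurs 2(n - 1) times, which cancels the factor 1/(n
- 1). For n = 1 the left side is 0. -/
theorem sum_norm_sub_le (hn : 1 ≤ n) :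
    1 / ((n : ℝ) - 1) * ∑ i, ∑ l ∈ Finset.univ.erase i, ‖x i - x l‖ ≤
      2 * (n * meanDeviation x) := by
  have hn1 : (1 : ℝ) ≤ n := by exact_mod_cast hn
  set S := ∑ i, ‖x i - mean x‖ with hS
  have hS0 : 0 ≤ S := Finset.sum_nonneg fun i _ => norm_nonneg _
  have hdev : n * meanDeviation x = S := by
    rw [meanDeviation, ← mul_assoc, mul_one_div_cancel (by linarith), one_mul]
  have h1 : ∑ i, ∑ l ∈ Finset.univ.erase i, ‖x i - x l‖ ≤ (n - 1) * (2 * S) := by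
    calc ∑ i, ∑ l ∈ Finset.univ.erase i, ‖x i - x l‖
        ≤ ∑ i, ∑ l ∈ Finset.univ.erase i, (‖x i - mean x‖ + ‖x l - mean x‖) := by
          refine Finset.sum_le_sum fun i _ => Finset.sum_le_sum fun l _ => ?_
          rw [norm_sub_rev (x l)]
          exact norm_sub_le_norm_sub_add_norm_sub _ _ _
      _ = ∑ i, ((n - 1) * ‖x i - mean x‖ + (S - ‖x i - mean x‖)) := by
          refine Finset.sum_congr rfl fun i _ => ?_
          rw [Finset.sum_add_distrib, hS, ← Finset.add_sum_erase _ _ (Finset.mem_univ i)]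
          simp [Nat.cast_sub hn]
      _ = (n - 1) * (2 * S) := by
          rw [Finset.sum_add_distrib, ← Finset.mul_sum, Finset.sum_sub_distrib, ← hS]
          simp
          ring
  rw [hdev]
  rcases eq_or_lt_of_le hn1 with h | h
  · rw [← h]
    simpa using hS0
  · have hpos : (0 : ℝ) < n - 1 := by linarith
    rw [one_div, inv_mul_le_iff₀ hpos]
    exact h1

theorem error_scale_le (hn : 1 ≤ n) (hk : 2 ≤ k) (hR : 0 < R) :
    (2 * R * spacing k / n) ^ 2 ≤ 36 * R ^ 2 / (n ^ 2 * k ^ 2) := by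
  have hn0 : (0 : ℝ) < n := by exact_mod_cast hn
  have hk0 : (0 : ℝ) < k := by exact_mod_cast (by omega : 0 < k)
  have hs := spacing_pos hk
  calc (2 * R * spacing k / n) ^ 2 ≤ (2 * R * (3 / k) / n) ^ 2 := by
        gcongr
        exact spacing_le hk
    _ = 36 * R ^ 2 / (n ^ 2 * k ^ 2) := by
        field_simp
        norm_num

theorem error_bound_of_sum_le (hn : 1 ≤ n) (hk : 2 ≤ k) (hR : 0 < R) {T B : ℝ} (hT : T ≤ B)
    (hB : 0 ≤ B) :
    (2 * R * spacing k / n) ^ 2 * T ≤ 36 * R ^ 2 / (n ^ 2 * k ^ 2) * B :=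
  (mul_le_mul_of_nonneg_left hT (sq_nonneg _)).trans
    (mul_le_mul_of_nonneg_right (error_scale_le hn hk hR) hB)

theorem meanDeviation_nonneg : 0 ≤ meanDeviation x :=
  mul_nonneg (by positivity) (Finset.sum_nonneg fun i _ => norm_nonneg _)

theorem sum_integral_coordError_sq_le_card (hn : 1 ≤ n) (hk : 2 ≤ k) (hR : 0 < R)
    (hx : ∀ i, ‖x i‖ ≤ R) :
    ∑ j, ∫ ω, coordError k (fun i => normalize R (x i j)) ω ^ 2 ∂coordLaw n k ≤
      d * (1 / 4 + n / 4) := by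
  calc _ ≤ ∑ _j : Fin d, (1 / 4 + n / 4 : ℝ) := Finset.sum_le_sum fun j _ =>
        integral_coordError_sq_le_card hn hk fun i => normalize_mem_Icc hR (abs_coord_le hx i j)
    _ = _ := by simp [mul_add]

/-- The factor 2k/R combines 2k from the random grid, 1/(2R) from normalization and 2 from the
triangle inequality. -/
theorem sum_integral_coordError_sq_le_dist (hn : 1 ≤ n) (hk : 2 ≤ k) (hR : 0 < R)
    (hx : ∀ i, ‖x i‖ ≤ R) :
    ∑ j, ∫ ω, coordError k (fun i => normalize R (x i j)) ω ^ 2 ∂coordLaw n k ≤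
      d / 4 + 2 * (k / R) * (√d * (n * meanDeviation x)) := by
  have hn1 : (1 : ℝ) ≤ n := by exact_mod_cast hn
  have hinv : 0 ≤ 1 / ((n : ℝ) - 1) := div_nonneg zero_le_one (by linarith)
  have hnorm : ∀ i l (j : Fin d), |normalize R (x i j) - normalize R (x l j)| =
      1 / (2 * R) * |(x i - x l) j| := by
    intro i l j
    have : normalize R (x i j) - normalize R (x l j) = 1 / (2 * R) * (x i - x l) j := by
      rw [PiLp.sub_apply]
      unfold normalize
      field_simp
      ring
    rw [this, abs_mul, abs_of_pos (by positivity)]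
  have hswap : ∑ j : Fin d, ∑ i, ∑ l ∈ Finset.univ.erase i,
      |normalize R (x i j) - normalize R (x l j)| ≤
      1 / (2 * R) * (√d * ∑ i, ∑ l ∈ Finset.univ.erase i, ‖x i - x l‖) := by
    rw [Finset.sum_comm, Finset.mul_sum, Finset.mul_sum]
    refine Finset.sum_le_sum fun i _ => ?_
    rw [Finset.sum_comm, Finset.mul_sum, Finset.mul_sum]
    refine Finset.sum_le_sum fun l _ => ?_
    simp_rw [hnorm i l]
    rw [← Finset.mul_sum]
    exact mul_le_mul_of_nonneg_left (sum_abs_le_sqrt_mul_norm _) (by positivity)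
  calc _ ≤ ∑ j : Fin d, (1 / 4 + 2 * k * (1 / ((n : ℝ) - 1) *
          ∑ i, ∑ l ∈ Finset.univ.erase i, |normalize R (x i j) - normalize R (x l j)|)) :=
        Finset.sum_le_sum fun j _ => integral_coordError_sq_le_dist hn hk fun i =>
          normalize_mem_Icc hR (abs_coord_le hx i j)
    _ = d / 4 + 2 * k * (1 / ((n : ℝ) - 1) * ∑ j : Fin d, ∑ i, ∑ l ∈ Finset.univ.erase i,
          |normalize R (x i j) - normalize R (x l j)|) := by
        rw [Finset.sum_add_distrib, ← Finset.mul_sum, ← Finset.mul_sum]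
        simp [div_eq_mul_inv]
    _ ≤ d / 4 + 2 * k * (1 / ((n : ℝ) - 1) *
          (1 / (2 * R) * (√d * ∑ i, ∑ l ∈ Finset.univ.erase i, ‖x i - x l‖))) := by
        gcongr
    _ = d / 4 + k / R * (√d * (1 / ((n : ℝ) - 1) *
          ∑ i, ∑ l ∈ Finset.univ.erase i, ‖x i - x l‖)) := by
        field_simp
    _ ≤ d / 4 + k / R * (√d * (2 * (n * meanDeviation x))) := by
        have : 0 ≤ (k : ℝ) / R := by positivity
        exact add_le_add le_rfl (mul_le_mul_of_nonneg_left
          (mul_le_mul_of_nonneg_left (sum_norm_sub_le hn) (Real.sqrt_nonneg _)) this)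
    _ = _ := by ring

/-- Since β ≤ 3/k, the squared scale is at most 36R²/(n²k²). Multiplying by the factor 2 of the
distance bound gives 72, and multiplying by 1/4 gives the 9 absorbed into 72². -/
theorem integral_norm_sq_error_le (hn : 1 ≤ n) (hk : 2 ≤ k) (code : PrefixCode (Fin d → Fin k))
    (hR : 0 < R) (hx : ∀ i, ‖x i‖ ≤ R) :
    ∫ ω, ‖estimate k (by omega) code R x ω - mean x‖ ^ 2 ∂seedLaw n d k ≤
      72 / n * min (√d * meanDeviation x * R / k) (d * R ^ 2 / k ^ 2) +
        72 ^ 2 * d * R ^ 2 / (n ^ 2 * k ^ 2) := by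
  have hn0 : (0 : ℝ) < n := by exact_mod_cast hn
  have hk0 : (0 : ℝ) < k := by exact_mod_cast (by omega : 0 < k)
  have hdev := meanDeviation_nonneg (x := x)
  rw [(integrable_norm_sq_error hn hk code hR hx).2]
  have hrest : 9 * (d * R ^ 2 / (n ^ 2 * k ^ 2)) ≤ 72 ^ 2 * d * R ^ 2 / (n ^ 2 * k ^ 2) := by
    have h : 72 ^ 2 * d * R ^ 2 / ((n : ℝ) ^ 2 * k ^ 2) =
        72 ^ 2 * (d * R ^ 2 / (n ^ 2 * k ^ 2)) := by ring
    rw [h]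
    exact mul_le_mul_of_nonneg_right (by norm_num) (by positivity)
  rcases min_cases (√d * meanDeviation x * R / k) (d * R ^ 2 / k ^ 2) with ⟨h, _⟩ | ⟨h, _⟩
  · rw [h]
    refine (error_bound_of_sum_le hn hk hR (sum_integral_coordError_sq_le_dist hn hk hR hx)
      (by positivity)).trans ?_
    have : 36 * R ^ 2 / ((n : ℝ) ^ 2 * k ^ 2) *
        (d / 4 + 2 * (k / R) * (√d * (n * meanDeviation x))) =
        72 / n * (√d * meanDeviation x * R / k) + 9 * (d * R ^ 2 / (n ^ 2 * k ^ 2)) := by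
      field_simp
      ring
    linarith
  · rw [h]
    refine (error_bound_of_sum_le hn hk hR (sum_integral_coordError_sq_le_card hn hk hR hx)
      (by positivity)).trans ?_
    have h1 : 36 * R ^ 2 / ((n : ℝ) ^ 2 * k ^ 2) * (d * (1 / 4 + n / 4)) =
        9 / n * (d * R ^ 2 / k ^ 2) + 9 * (d * R ^ 2 / (n ^ 2 * k ^ 2)) := by
      field_simp
      ring
    have h2 : 9 / n * (d * R ^ 2 / k ^ 2) ≤ 72 / n * (d * R ^ 2 / (k : ℝ) ^ 2) := by
      gcongr
      norm_num
    linarith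

/-! ### Communication -/

theorem measurable_quantize (hk : 0 < k) (i : Fin n) (v : EuclideanSpace ℝ (Fin d)) :
    Measurable fun ω : Seed n d => quantize k hk R i ω.1 (ω.2 i) v := by
  classical
  refine measurable_pi_iff.2 fun j => ?_
  have hc : Measurable fun ω : Seed n d => (ω.1 j).2 := by fun_prop
  have hγ : Measurable fun ω : Seed n d => ω.2 i j := by fun_prop
  have hp : Measurable fun ω : Seed n d => ((((ω.1 j).1 i : Fin n) : ℕ) : ℝ) :=
    (measurable_from_top (f := fun π : Equiv.Perm (Fin n) => (((π i : Fin n) : ℕ) : ℝ))).comp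
      (by fun_prop : Measurable fun ω : Seed n d => (ω.1 j).1)
  have hU : Measurable fun ω : Seed n d => threshold n ((ω.1 j).1 i : ℕ) (ω.2 i j) := by
    unfold threshold
    fun_prop
  have hround : Measurable fun ω : Seed n d => roundIndex k (ω.1 j).2 (normalize R (v j))
      (threshold n ((ω.1 j).1 i : ℕ) (ω.2 i j)) := by
    unfold roundIndex
    exact ((measurable_lowerIndex k _).comp hc).add (Measurable.ite
      (measurableSet_lt hU ((measurable_cellPosition k _).comp hc)) measurable_const
      measurable_const)
  exact (measurable_from_top (f := fun m : ℕ => (⟨min m (k - 1), by omega⟩ : Fin k))).comp hround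

theorem ae_bits_le (hd : 1 ≤ d) (hn : 1 ≤ n) (hk : 2 ≤ k) (hR : 0 < R) (hx : ∀ i, ‖x i‖ ≤ R)
    (i : Fin n) :
    ∀ᵐ ω ∂seedLaw n d k, (bits k (by omega) (offsetCode d k (by omega)) R x i ω : ℝ) ≤
      10 * (d * (1 + Real.logb 2 (((k : ℝ) - 1) ^ 2 / (2 * d) + 1))) := by
  filter_upwards [ae_seedLaw hn hk] with ω hω
  -- The deviation of a normalized coordinate from 1/2 is x(j)/(2R), so the squares sum to
  -- ‖x‖²/(4R²) ≤ 1/4.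
  refine length_offsetCode_le hd hk _ (fun j => normalize R (x i j) - 1 / 2) ?_ fun j => ?_
  · have hcoord : ∀ j, (normalize R (x i j) - 1 / 2) ^ 2 = 1 / (4 * R ^ 2) * x i j ^ 2 := by
      intro j
      unfold normalize
      field_simp
      ring
    simp_rw [hcoord]
    rw [← Finset.mul_sum, ← EuclideanSpace.real_norm_sq_eq, one_div_mul_eq_div,
      div_le_div_iff₀ (by positivity) (by norm_num)]
    have := pow_le_pow_left₀ (norm_nonneg _) (hx i) 2
    linarith
  · rw [quantize_val hk hR hx (ω.2 i) i (hω j)]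
    exact abs_roundIndex_sub_half_le hk (hω j) (normalize_mem_Icc hR (abs_coord_le hx i j)) _

theorem integrable_bits (hd : 1 ≤ d) (hn : 1 ≤ n) (hk : 2 ≤ k) (hR : 0 < R)
    (hx : ∀ i, ‖x i‖ ≤ R) (i : Fin n) :
    Integrable (fun ω => (bits k (by omega) (offsetCode d k (by omega)) R x i ω : ℝ))
      (seedLaw n d k) := by
  have := isProbabilityMeasure_seedLaw (d := d) hn hk
  refine Integrable.of_bound (Measurable.aestronglyMeasurable
    ((measurable_of_countable fun v : Fin d → Fin k =>
      (((offsetCode d k (by omega)).encode v).length : ℝ)).comp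
        (measurable_quantize (by omega) i (x i))))
    (10 * (d * (1 + Real.logb 2 (((k : ℝ) - 1) ^ 2 / (2 * d) + 1)))) ?_
  · filter_upwards [ae_bits_le hd hn hk hR hx i] with ω hω
    rwa [Real.norm_eq_abs, abs_of_nonneg (Nat.cast_nonneg _)]

theorem integral_bits_le (hd : 1 ≤ d) (hn : 1 ≤ n) (hk : 2 ≤ k) (hR : 0 < R)
    (hx : ∀ i, ‖x i‖ ≤ R) (i : Fin n) :
    ∫ ω, (bits k (by omega) (offsetCode d k (by omega)) R x i ω : ℝ) ∂seedLaw n d k ≤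
      10 * (d * (1 + Real.logb 2 (((k : ℝ) - 1) ^ 2 / (2 * d) + 1))) := by
  have := isProbabilityMeasure_seedLaw (d := d) hn hk
  refine (integral_mono_ae (integrable_bits hd hn hk hR hx i) (integrable_const _)
    (ae_bits_le hd hn hk hR hx i)).trans ?_
  rw [integral_const, probReal_univ, one_smul]

/-- The offset code does not incur this term, so the claimed bit bound only needs it to be
nonnegative. -/
theorem type_cost_nonneg (d : ℕ) (hk : 2 ≤ k) :
    0 ≤ k * Real.logb 2 (((k : ℝ) + d) * Real.exp 1 / k) := by
  have hk0 : (0 : ℝ) < k := by exact_mod_cast (by omega : 0 < k)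
  refine mul_nonneg hk0.le (Real.logb_nonneg (by norm_num) ?_)
  rw [le_div_iff₀ hk0, one_mul]
  have h1 : (1 : ℝ) ≤ Real.exp 1 := Real.one_le_exp zero_le_one
  have h2 : (0 : ℝ) ≤ d := by positivity
  nlinarith

end Bounds

end EntropyCQ

theorem corollary1 :
    ∃ c C : ℝ, 0 < c ∧ 0 < C ∧
      ∀ (d k : ℕ) (_hd : 1 ≤ d) (hk : 2 ≤ k),
        ∃ code : EntropyCQ.PrefixCode (Fin d → Fin k),
          ∀ (n : ℕ) (_hn : 1 ≤ n) (R : ℝ) (_hR : 0 < R)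
            (x : Fin n → EuclideanSpace ℝ (Fin d)) (_hx : ∀ i, ‖x i‖ ≤ R),
            -- the estimate is integrable and unbiased
            (MeasureTheory.Integrable
                (EntropyCQ.estimate k (by omega) code R x) (EntropyCQ.seedLaw n d k) ∧
              ∫ ω, EntropyCQ.estimate k (by omega) code R x ω ∂(EntropyCQ.seedLaw n d k) =
                EntropyCQ.mean x) ∧
            -- the mean squared error is finite and bounded
            (MeasureTheory.Integrable
                (fun ω => ‖EntropyCQ.estimate k (by omega) code R x ω - EntropyCQ.mean x‖ ^ 2)
                (EntropyCQ.seedLaw n d k) ∧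
              ∫ ω, ‖EntropyCQ.estimate k (by omega) code R x ω - EntropyCQ.mean x‖ ^ 2
                  ∂(EntropyCQ.seedLaw n d k) ≤
                c / n * min (√d * EntropyCQ.meanDeviation x * R / k) (d * R ^ 2 / k ^ 2) +
                  c ^ 2 * d * R ^ 2 / (n ^ 2 * k ^ 2)) ∧
            -- the expected number of bits sent by each client is finite and bounded
            ∀ i : Fin n,
              MeasureTheory.Integrable
                  (fun ω => (EntropyCQ.bits k (by omega) code R x i ω : ℝ))
                  (EntropyCQ.seedLaw n d k) ∧
                ∫ ω, (EntropyCQ.bits k (by omega) code R x i ω : ℝ)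
                    ∂(EntropyCQ.seedLaw n d k) ≤
                  C * (d * (1 + Real.logb 2 (((k : ℝ) - 1) ^ 2 / (2 * d) + 1))) +
                    k * Real.logb 2 ((k + d) * Real.exp 1 / k) + C := by
  refine ⟨72, 10, by norm_num, by norm_num, fun d k hd hk =>
    ⟨EntropyCQ.offsetCode d k (by omega), fun n hn R hR x hx =>
      ⟨⟨EntropyCQ.integrable_estimate hn hk _ hR hx, EntropyCQ.integral_estimate hn hk _ hR hx⟩,
        ⟨(EntropyCQ.integrable_norm_sq_error hn hk _ hR hx).1,
          EntropyCQ.integral_norm_sq_error_le hn hk _ hR hx⟩, fun i =>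
        ⟨EntropyCQ.integrable_bits hd hn hk hR hx i, ?_⟩⟩⟩⟩
  have h1 := EntropyCQ.integral_bits_le hd hn hk hR hx i
  have h2 := EntropyCQ.type_cost_nonneg d hk
  linarith
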